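/- Let $d\ge 1$ be an integer, let $1<p<2$, and let $p'=p/(p-1)$. Let $\mathbb{T}^d=[-\pi,\pi]^d$ carry Lebesgue measure, and let $L^p(\mathbb{T}^d)$ be the usual space of complex-valued functions. Let $l^{p',p}(\mathbb{Z}^d)$ be the Lorentz sequence space of all $c=(c_m)_{m\in\mathbb{Z}^d}$, $c_m\in\mathbb{C}$, with $$\|c\|_{p',p}=\Big(\sum_{k=1}^{\infty}\big(k^{1/p'-1/p}\,c_k^*\big)^p\Big)^{1/p}<\infty,$$ where $c_k^*=\inf\{\tau\ge 0:\ \#\{m\in\mathbb{Z}^d:|c_m|>\tau\}\le k-1\}$ ($k\ge1$) is the non-increasing rearrangement of $c$. Then the discrete Fourier transform $$f\mapsto \Big(\int_{\mathbb{T}^d} f(t)\,e^{-i\langle t,m\rangle}\,dt\Big)_{m\in\mathbb{Z}^d}$$ is a bounded linear operator from $L^p(\mathbb{T}^d)$ into $l^{p',p}(\mathbb{Z}^d)$, but it is not strictly singular. Here a bounded linear operator $T:X\to Y$ is called strictly singular if for every infinite-dimensional closed subspace $E\subset X$ and every $\varepsilon>0$ there is $x\in E$ with $\|x\|_X=1$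 and $\|Tx\|_Y\le\varepsilon$. -/

import Mathlib

open MeasureTheory
open scoped ENNReal

noncomputable section

/-! ### Strict singularity -/

/-- A bounded linear operator `T : X → Y` is strictly singular if for every infinite-dimensional
closed subspace `E` of `X` and every `ε > 0` there is `x` in the unit sphere of `E` with
`‖T x‖ ≤ ε`. -/
def StrictlySingular {X Y : Type*} [NormedAddCommGroup X] [NormedSpace ℂ X]
    [NormedAddCommGroup Y] [NormedSpace ℂ Y] (T : X →L[ℂ] Y) : Prop :=
  ∀ E : Submodule ℂ X, IsClosed (E : Set X) → ¬ FiniteDimensional ℂ E →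
    ∀ ε : ℝ, 0 < ε → ∃ x ∈ E, ‖x‖ = 1 ∧ ‖T x‖ ≤ ε

/-! ### Lorentz sequence spaces -/

namespace Lorentz

variable {ι : Type*}

/-- The non-increasing rearrangement of a family `c`, indexed from `0`:
`rearr c k` is the usual `c*_{k+1} = inf {τ ≥ 0 | #{m | |c m| > τ} ≤ k}`
(an element of `[0, ∞]`; it is `∞` iff `c` is unbounded). -/
def rearr (c : ι → ℂ) (k : ℕ) : ℝ≥0∞ :=
  sInf {τ : ℝ≥0∞ | {m | τ < ‖c m‖ₑ}.encard ≤ k}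

/-- The weight `k ^ (1/r - 1/s)`, where `k` is shifted by one. -/
def weight (r s : ℝ) (k : ℕ) : ℝ≥0∞ := ((k : ℝ≥0∞) + 1) ^ (1 / r - 1 / s)

/-- The Lorentz functional `‖c‖_{r,s} = (∑_{k ≥ 1} (k ^ (1/r - 1/s) c*_k) ^ s) ^ (1/s)`,
with values in `[0, ∞]`. -/
def eNorm (r s : ℝ) (c : ι → ℂ) : ℝ≥0∞ :=
  (∑' k : ℕ, (weight r s k * rearr c k) ^ s) ^ (1 / s)

lemma rearr_antitone (c : ι → ℂ) : Antitone (rearr c) := by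
  intro k l hkl
  apply sInf_le_sInf
  intro τ hτ
  have hτ' : {m | τ < ‖c m‖ₑ}.encard ≤ (k : ℕ∞) := hτ
  exact hτ'.trans (by exact_mod_cast hkl)

lemma le_rearr_zero (c : ι → ℂ) (m : ι) : ‖c m‖ₑ ≤ rearr c 0 := by
  refine le_sInf fun τ hτ => ?_
  by_contra h
  have hτ' : {m | τ < ‖c m‖ₑ}.encard ≤ 0 := by simpa using hτ
  have h0 : {m | τ < ‖c m‖ₑ} = ∅ := by simpa using hτ'
  have : m ∈ {m | τ < ‖c m‖ₑ} := not_le.1 h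
  rw [h0] at this
  exact this

lemma rearr_zero_fun (k : ℕ) : rearr (0 : ι → ℂ) k = 0 := by
  refine le_antisymm (sInf_le ?_) bot_le
  simp

lemma rearr_zero_le {c : ι → ℂ} {M : ℝ≥0∞} (h : ∀ m, ‖c m‖ₑ ≤ M) : rearr c 0 ≤ M := by
  refine sInf_le ?_
  have : {m | M < ‖c m‖ₑ} = ∅ := by
    ext m; simpa using h m
  simp [this]

lemma rearr_smul_le (a : ℂ) (c : ι → ℂ) (k : ℕ) : rearr (a • c) k ≤ ‖a‖ₑ * rearr c k := by
  rcases eq_or_ne a 0 with rfl | ha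
  · simp [rearr_zero_fun]
  have ha0 : ‖a‖ₑ ≠ 0 := by simpa using ha
  have hat : ‖a‖ₑ ≠ ∞ := enorm_ne_top
  have key : ‖a‖ₑ⁻¹ * rearr (a • c) k ≤ rearr c k := by
    refine le_sInf fun τ hτ => ?_
    have h1 : rearr (a • c) k ≤ ‖a‖ₑ * τ := by
      refine sInf_le ?_
      refine le_trans (Set.encard_le_encard ?_) hτ
      intro m hm
      simp only [Set.mem_ofPred_eq, Pi.smul_apply, enorm_smul] at hm ⊢
      exact lt_of_mul_lt_mul_left' hm
    calc ‖a‖ₑ⁻¹ * rearr (a • c) k ≤ ‖a‖ₑ⁻¹ * (‖a‖ₑ * τ) := by gcongr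
      _ = τ := by rw [← mul_assoc, ENNReal.inv_mul_cancel ha0 hat, one_mul]
  calc rearr (a • c) k = ‖a‖ₑ * (‖a‖ₑ⁻¹ * rearr (a • c) k) := by
        rw [← mul_assoc, ENNReal.mul_inv_cancel ha0 hat, one_mul]
    _ ≤ _ := by gcongr

lemma weight_zero (r s : ℝ) : weight r s 0 = 1 := by simp [weight]

lemma weight_antitone {r s : ℝ} (hs : 1 ≤ s) (hr : s ≤ r) : Antitone (weight r s) := by
  intro k l hkl
  have hexp : 1 / r - 1 / s ≤ 0 := by
    have := one_div_le_one_div_of_le (by linarith : 0 < s) hr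
    linarith
  have hkl' : (k : ℝ≥0∞) + 1 ≤ (l : ℝ≥0∞) + 1 := by gcongr
  obtain ⟨t, ht⟩ : ∃ t, t = -(1 / r - 1 / s) := ⟨_, rfl⟩
  have ht' : 1 / r - 1 / s = -t := by linarith
  have ht0 : 0 ≤ t := by linarith
  simp only [weight, ht', ENNReal.rpow_neg]
  exact ENNReal.inv_le_inv.2 (ENNReal.rpow_le_rpow hkl' ht0)

lemma eNorm_smul_le {r s : ℝ} (hs : 1 ≤ s) (a : ℂ) (c : ι → ℂ) :
    eNorm r s (a • c) ≤ ‖a‖ₑ * eNorm r s c := by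
  have hs0 : 0 < s := by linarith
  have h1 : ∑' k : ℕ, (weight r s k * rearr (a • c) k) ^ s ≤
      ‖a‖ₑ ^ s * ∑' k : ℕ, (weight r s k * rearr c k) ^ s := by
    rw [← ENNReal.tsum_mul_left]
    refine ENNReal.tsum_le_tsum fun k => ?_
    rw [← ENNReal.mul_rpow_of_nonneg _ _ hs0.le]
    refine ENNReal.rpow_le_rpow ?_ hs0.le
    calc weight r s k * rearr (a • c) k ≤ weight r s k * (‖a‖ₑ * rearr c k) := by
          gcongr; exact rearr_smul_le a c k
      _ = _ := by ring
  calc eNorm r s (a • c) ≤ (‖a‖ₑ ^ s * ∑' k : ℕ, (weight r s k * rearr c k) ^ s) ^ (1 / s) :=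
        ENNReal.rpow_le_rpow h1 (by positivity)
    _ = _ := by
      rw [ENNReal.mul_rpow_of_nonneg _ _ (by positivity), ← ENNReal.rpow_mul,
        mul_one_div_cancel hs0.ne', ENNReal.rpow_one, eNorm]

lemma eNorm_smul {r s : ℝ} (hs : 1 ≤ s) (a : ℂ) (c : ι → ℂ) :
    eNorm r s (a • c) = ‖a‖ₑ * eNorm r s c := by
  refine le_antisymm (eNorm_smul_le hs a c) ?_
  rcases eq_or_ne a 0 with rfl | ha
  · simp
  have ha0 : ‖a‖ₑ ≠ 0 := by simpa using ha
  have hat : ‖a‖ₑ ≠ ∞ := enorm_ne_top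
  have h := eNorm_smul_le (r := r) hs a⁻¹ (a • c)
  rw [smul_smul, inv_mul_cancel₀ ha, one_smul, enorm_inv ha] at h
  calc ‖a‖ₑ * eNorm r s c ≤ ‖a‖ₑ * (‖a‖ₑ⁻¹ * eNorm r s (a • c)) := by gcongr
    _ = _ := by rw [← mul_assoc, ENNReal.mul_inv_cancel ha0 hat, one_mul]

lemma rearr_zero_le_eNorm {r s : ℝ} (hs : 1 ≤ s) (c : ι → ℂ) : rearr c 0 ≤ eNorm r s c := by
  have hs0 : 0 < s := by linarith
  have h := ENNReal.le_tsum (f := fun k : ℕ => (weight r s k * rearr c k) ^ s) 0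
  simp only [weight_zero, one_mul] at h
  calc rearr c 0 = (rearr c 0 ^ s) ^ (1 / s) := by
        rw [← ENNReal.rpow_mul, mul_one_div_cancel hs0.ne', ENNReal.rpow_one]
    _ ≤ _ := ENNReal.rpow_le_rpow h (by positivity)

lemma eNorm_zero {r s : ℝ} (hs : 1 ≤ s) : eNorm r s (0 : ι → ℂ) = 0 := by
  have hs0 : 0 < s := by linarith
  simp [eNorm, rearr_zero_fun, hs0]

lemma eq_zero_of_eNorm {r s : ℝ} (hs : 1 ≤ s) {c : ι → ℂ} (h : eNorm r s c = 0) : c = 0 := by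
  ext m
  have := (le_rearr_zero c m).trans (rearr_zero_le_eNorm (r := r) hs c)
  rw [h] at this
  simpa using this

/-- Summation by parts. -/
lemma sum_mul_le_of_partial (n : ℕ) : ∀ (w a b : ℕ → ℝ≥0∞), Antitone w →
    (∀ j, ∑ k ∈ Finset.range j, a k ≤ ∑ k ∈ Finset.range j, b k) →
    ∑ k ∈ Finset.range n, w k * a k ≤ ∑ k ∈ Finset.range n, w k * b k := by
  induction n with
  | zero => intro w a b _ _; simp
  | succ n ih =>
    intro w a b hw hab
    have key : ∀ x : ℕ → ℝ≥0∞, ∑ k ∈ Finset.range (n + 1), w k * x k =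
        ∑ k ∈ Finset.range n, (w k - w n) * x k + w n * ∑ k ∈ Finset.range (n + 1), x k := by
      intro x
      rw [Finset.sum_range_succ, Finset.sum_range_succ, mul_add, ← add_assoc, Finset.mul_sum,
        ← Finset.sum_add_distrib]
      congr 1
      refine Finset.sum_congr rfl fun k hk => ?_
      rw [← add_mul, tsub_add_cancel_of_le (hw (Finset.mem_range.1 hk).le)]
    rw [key a, key b]
    exact add_le_add (ih (fun k => w k - w n) a b (fun k l h => tsub_le_tsub_right (hw h) _) hab)
      (mul_le_mul_right (hab (n + 1)) _)

lemma sum_finset_le (c : ι → ℂ) {s : ℝ} (hs : 0 ≤ s) (j : ℕ) : ∀ A : Finset ι, A.card = j →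
    ∑ m ∈ A, ‖c m‖ₑ ^ s ≤ ∑ k ∈ Finset.range j, rearr c k ^ s := by
  classical
  induction j with
  | zero => intro A hA; simp [Finset.card_eq_zero.1 hA]
  | succ j ih =>
    intro A hA
    have hne : A.Nonempty := Finset.card_pos.1 (by omega)
    obtain ⟨m, hm, hmin⟩ := Finset.exists_min_image A (fun m => ‖c m‖ₑ) hne
    have h1 : ‖c m‖ₑ ≤ rearr c j := by
      refine le_sInf fun τ hτ => ?_
      by_contra hlt
      have hsub : (A : Set ι) ⊆ {m | τ < ‖c m‖ₑ} := fun x hx =>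
        lt_of_lt_of_le (not_le.1 hlt) (hmin x hx)
      have h2 := (Set.encard_le_encard hsub).trans hτ
      rw [Set.encard_coe_eq_coe_finsetCard, hA] at h2
      have : j + 1 ≤ j := by exact_mod_cast h2
      omega
    rw [← Finset.sum_erase_add A _ hm, Finset.sum_range_succ]
    exact add_le_add (ih _ (by rw [Finset.card_erase_of_mem hm, hA]; rfl))
      (ENNReal.rpow_le_rpow h1 hs)

lemma sum_inj_le {r s : ℝ} (hs : 1 ≤ s) (hr : s ≤ r) (c : ι → ℂ) (n : ℕ) (K : Finset ℕ)
    (hK : K ⊆ Finset.range n) (e : ℕ → ι) (he : Set.InjOn e K) :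
    (∑ k ∈ K, (weight r s k * ‖c (e k)‖ₑ) ^ s) ^ (1 / s) ≤ eNorm r s c := by
  classical
  have hs0 : 0 < s := by linarith
  refine ENNReal.rpow_le_rpow ?_ (by positivity)
  have hpart : ∀ j, ∑ k ∈ Finset.range j, (if k ∈ K then ‖c (e k)‖ₑ ^ s else 0) ≤
      ∑ k ∈ Finset.range j, rearr c k ^ s := by
    intro j
    rw [← Finset.sum_filter]
    have hinj : Set.InjOn e ((Finset.range j).filter (· ∈ K) : Finset ℕ) :=
      he.mono (fun k hk => by simpa using (Finset.mem_filter.1 hk).2)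
    rw [← Finset.sum_image (f := fun m => ‖c m‖ₑ ^ s) (g := e) hinj]
    refine (sum_finset_le c hs0.le _ _ rfl).trans ?_
    refine Finset.sum_le_sum_of_subset ?_
    refine Finset.range_mono ?_
    refine Finset.card_image_le.trans ((Finset.card_filter_le _ _).trans ?_)
    simp
  have hw : Antitone fun k => weight r s k ^ s := fun k l h =>
    ENNReal.rpow_le_rpow (weight_antitone hs hr h) hs0.le
  have h := sum_mul_le_of_partial n _ _ _ hw hpart
  calc ∑ k ∈ K, (weight r s k * ‖c (e k)‖ₑ) ^ s
      = ∑ k ∈ Finset.range n, weight r s k ^ s * (if k ∈ K then ‖c (e k)‖ₑ ^ s else 0) := by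
        simp only [mul_ite, mul_zero]
        rw [← Finset.sum_filter, Finset.filter_mem_eq_inter, Finset.inter_eq_right.2 hK]
        exact Finset.sum_congr rfl fun k _ => ENNReal.mul_rpow_of_nonneg _ _ hs0.le
    _ ≤ _ := h
    _ = ∑ k ∈ Finset.range n, (weight r s k * rearr c k) ^ s :=
        Finset.sum_congr rfl fun k _ => (ENNReal.mul_rpow_of_nonneg _ _ hs0.le).symm
    _ ≤ _ := ENNReal.sum_le_tsum _

lemma exists_inj [Nonempty ι] (f : ι → ℂ) (τ : ℕ → ℝ≥0∞) (n : ℕ) : ∃ e : ℕ → ι,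
    Set.InjOn e {k | k < n ∧ τ k < rearr f k} ∧
      ∀ k, k < n → τ k < rearr f k → τ k < ‖f (e k)‖ₑ := by
  classical
  induction n with
  | zero => exact ⟨fun _ => Classical.arbitrary ι, by simp [Set.InjOn], by simp⟩
  | succ n ih =>
    obtain ⟨e, he, hτ⟩ := ih
    by_cases hn : τ n < rearr f n
    · have hcard : (n : ℕ∞) < {m | τ n < ‖f m‖ₑ}.encard := by
        by_contra h
        have hle : rearr f n ≤ τ n := sInf_le (not_lt.1 h)
        exact absurd hle (not_le.2 hn)
      obtain ⟨m, hm, hme⟩ : ∃ m ∈ {m | τ n < ‖f m‖ₑ}, m ∉ (Finset.range n).image e := by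
        by_contra hcon
        push Not at hcon
        have hsub : {m | τ n < ‖f m‖ₑ} ⊆ (((Finset.range n).image e : Finset ι) : Set ι) :=
          fun m hm => hcon m hm
        have h1 := Set.encard_le_encard hsub
        rw [Set.encard_coe_eq_coe_finsetCard] at h1
        have h2 : (((Finset.range n).image e).card : ℕ∞) ≤ n := by
          exact_mod_cast Finset.card_image_le.trans (by simp)
        exact absurd (h1.trans h2) (not_le.2 hcard)
      have hme' : ∀ k < n, e k ≠ m := fun k hk h =>
        hme (Finset.mem_image.2 ⟨k, Finset.mem_range.2 hk, h⟩)
      refine ⟨Function.update e n m, ?_, ?_⟩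
      · rintro k ⟨hk, hk'⟩ l ⟨hl, hl'⟩ hkl
        rcases Nat.lt_succ_iff_lt_or_eq.1 hk with hk | rfl <;>
          rcases Nat.lt_succ_iff_lt_or_eq.1 hl with hl | rfl
        · rw [Function.update_of_ne hk.ne, Function.update_of_ne hl.ne] at hkl
          exact he ⟨hk, hk'⟩ ⟨hl, hl'⟩ hkl
        · rw [Function.update_of_ne hk.ne, Function.update_self] at hkl
          exact absurd hkl (hme' k hk)
        · rw [Function.update_of_ne hl.ne, Function.update_self] at hkl
          exact absurd hkl.symm (hme' l hl)
        · rfl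
      · intro k hk hk'
        rcases Nat.lt_succ_iff_lt_or_eq.1 hk with hk | rfl
        · rw [Function.update_of_ne hk.ne]; exact hτ k hk hk'
        · rw [Function.update_self]; exact hm
    · have hlt : ∀ k, k < n + 1 → τ k < rearr f k → k < n := fun k hk hk' => by
        rcases Nat.lt_succ_iff_lt_or_eq.1 hk with hk | rfl
        · exact hk
        · exact absurd hk' hn
      have hsub : {k | k < n + 1 ∧ τ k < rearr f k} ⊆ {k | k < n ∧ τ k < rearr f k} :=
        fun k hk => ⟨hlt k hk.1 hk.2, hk.2⟩
      exact ⟨e, he.mono hsub, fun k hk hk' => hτ k (hlt k hk hk') hk'⟩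

/-- For `1 ≤ s ≤ r` the Lorentz functional satisfies the triangle inequality. -/
lemma eNorm_add_le {r s : ℝ} (hs : 1 ≤ s) (hr : s ≤ r) (c d : ι → ℂ) :
    eNorm r s (c + d) ≤ eNorm r s c + eNorm r s d := by
  classical
  have hs0 : 0 < s := by linarith
  rcases isEmpty_or_nonempty ι with hι | hι
  · rw [Subsingleton.elim (c + d) 0, eNorm_zero hs]; exact bot_le
  by_cases htop : eNorm r s c + eNorm r s d = ∞
  · rw [htop]; exact le_top
  have hfin : ∀ k, rearr (c + d) k ≠ ∞ := by
    intro k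
    refine ne_top_of_le_ne_top htop ((rearr_antitone _ (Nat.zero_le k)).trans
      (rearr_zero_le fun m => ?_))
    refine (enorm_add_le (c m) (d m)).trans (add_le_add ?_ ?_)
    · exact (le_rearr_zero c m).trans (rearr_zero_le_eNorm hs c)
    · exact (le_rearr_zero d m).trans (rearr_zero_le_eNorm hs d)
  refine ENNReal.le_of_forall_lt_one_mul_le fun θ hθ => ?_
  set τ : ℕ → ℝ≥0∞ := fun k => θ * rearr (c + d) k with hτdef
  have hpart : ∀ n : ℕ, ∑ k ∈ Finset.range n, (weight r s k * τ k) ^ s ≤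
      (eNorm r s c + eNorm r s d) ^ s := by
    intro n
    obtain ⟨e, he, hτ⟩ := exists_inj (c + d) τ n
    set K : Finset ℕ := (Finset.range n).filter (fun k => τ k < rearr (c + d) k) with hK
    have hKn : K ⊆ Finset.range n := Finset.filter_subset _ _
    have heK : Set.InjOn e K := he.mono fun k hk => by simpa [hK] using hk
    have h1 : ∑ k ∈ Finset.range n, (weight r s k * τ k) ^ s =
        ∑ k ∈ K, (weight r s k * τ k) ^ s := by
      refine (Finset.sum_subset hKn fun k hk hkK => ?_).symm
      have h0 : rearr (c + d) k = 0 := by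
        by_contra hne
        refine hkK (Finset.mem_filter.2 ⟨hk, ?_⟩)
        calc τ k < 1 * rearr (c + d) k := ENNReal.mul_lt_mul_left hne (hfin k) hθ
          _ = _ := one_mul _
      simp [hτdef, h0, hs0]
    rw [h1]
    have h2 : ∑ k ∈ K, (weight r s k * τ k) ^ s ≤
        ∑ k ∈ K, (weight r s k * ‖c (e k)‖ₑ + weight r s k * ‖d (e k)‖ₑ) ^ s := by
      refine Finset.sum_le_sum fun k hk => ENNReal.rpow_le_rpow ?_ hs0.le
      rw [← mul_add]
      gcongr
      have hk' := Finset.mem_filter.1 hk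
      exact (hτ k (Finset.mem_range.1 hk'.1) hk'.2).le.trans (enorm_add_le _ _)
    have h3 := ENNReal.Lp_add_le K (fun k => weight r s k * ‖c (e k)‖ₑ)
      (fun k => weight r s k * ‖d (e k)‖ₑ) hs
    have h4 := h3.trans (add_le_add (sum_inj_le hs hr c n K hKn e heK)
      (sum_inj_le hs hr d n K hKn e heK))
    refine h2.trans ?_
    have h5 := ENNReal.rpow_le_rpow h4 hs0.le
    rwa [← ENNReal.rpow_mul, one_div_mul_cancel hs0.ne', ENNReal.rpow_one] at h5
  have hsum : ∑' k : ℕ, (weight r s k * τ k) ^ s ≤ (eNorm r s c + eNorm r s d) ^ s := by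
    rw [ENNReal.tsum_eq_iSup_nat]
    exact iSup_le hpart
  have heq : ∑' k : ℕ, (weight r s k * τ k) ^ s =
      θ ^ s * ∑' k : ℕ, (weight r s k * rearr (c + d) k) ^ s := by
    rw [← ENNReal.tsum_mul_left]
    congr 1
    ext k
    rw [← ENNReal.mul_rpow_of_nonneg _ _ hs0.le, hτdef]
    congr 1
    ring
  rw [heq] at hsum
  have h6 := ENNReal.rpow_le_rpow hsum (by positivity : 0 ≤ 1 / s)
  rwa [ENNReal.mul_rpow_of_nonneg _ _ (by positivity), ← ENNReal.rpow_mul, ← ENNReal.rpow_mul,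
    mul_one_div_cancel hs0.ne', ENNReal.rpow_one, ENNReal.rpow_one] at h6

/-- The families of finite Lorentz norm, as a linear subspace of all families. -/
def finiteNorm (ι : Type*) (r s : ℝ) [hs : Fact (1 ≤ s)] [hr : Fact (s ≤ r)] :
    Submodule ℂ (ι → ℂ) where
  carrier := {c | eNorm r s c < ∞}
  zero_mem' := by simp [eNorm_zero hs.out]
  add_mem' {c d} hc hd :=
    (eNorm_add_le hs.out hr.out c d).trans_lt (ENNReal.add_lt_top.2 ⟨hc, hd⟩)
  smul_mem' a c hc := by
    simp only [Set.mem_ofPred_eq, eNorm_smul hs.out]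
    exact ENNReal.mul_lt_top enorm_lt_top hc

end Lorentz

/-- The Lorentz sequence space `l^{r,s}(ι)`, `1 ≤ s ≤ r`: all `c : ι → ℂ` with
`‖c‖_{r,s} < ∞`, normed by `‖·‖_{r,s}`. -/
def LorentzSeq (ι : Type*) (r s : ℝ) [Fact (1 ≤ s)] [Fact (s ≤ r)] : Type _ :=
  Lorentz.finiteNorm ι r s

namespace LorentzSeq

variable {ι : Type*} {r s : ℝ} [hs : Fact (1 ≤ s)] [hr : Fact (s ≤ r)]

instance : AddCommGroup (LorentzSeq ι r s) :=
  inferInstanceAs (AddCommGroup (Lorentz.finiteNorm ι r s))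

instance : Module ℂ (LorentzSeq ι r s) :=
  inferInstanceAs (Module ℂ (Lorentz.finiteNorm ι r s))

instance : CoeFun (LorentzSeq ι r s) (fun _ => ι → ℂ) := ⟨fun c => c.1⟩

instance : Norm (LorentzSeq ι r s) := ⟨fun c => (Lorentz.eNorm r s (c : ι → ℂ)).toReal⟩

lemma core : NormedSpace.Core ℂ (LorentzSeq ι r s) where
  norm_nonneg _ := ENNReal.toReal_nonneg
  norm_smul a c := by
    change (Lorentz.eNorm r s (a • c.1)).toReal = ‖a‖ * (Lorentz.eNorm r s c.1).toReal
    rw [Lorentz.eNorm_smul hs.out, ENNReal.toReal_mul, toReal_enorm]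
  norm_triangle c d := by
    change (Lorentz.eNorm r s (c.1 + d.1)).toReal ≤
      (Lorentz.eNorm r s c.1).toReal + (Lorentz.eNorm r s d.1).toReal
    have hc : Lorentz.eNorm r s c.1 ≠ ∞ := ne_of_lt c.2
    have hd : Lorentz.eNorm r s d.1 ≠ ∞ := ne_of_lt d.2
    rw [← ENNReal.toReal_add hc hd]
    exact ENNReal.toReal_mono (ENNReal.add_ne_top.2 ⟨hc, hd⟩)
      (Lorentz.eNorm_add_le hs.out hr.out c.1 d.1)
  norm_eq_zero_iff c := by
    change (Lorentz.eNorm r s c.1).toReal = 0 ↔ c = 0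
    constructor
    · intro h
      rcases (ENNReal.toReal_eq_zero_iff _).1 h with h | h
      · exact Subtype.ext (Lorentz.eq_zero_of_eNorm hs.out h)
      · exact absurd h (ne_of_lt c.2)
    · rintro rfl
      change (Lorentz.eNorm r s (0 : ι → ℂ)).toReal = 0
      rw [Lorentz.eNorm_zero hs.out, ENNReal.toReal_zero]

instance : NormedAddCommGroup (LorentzSeq ι r s) := NormedAddCommGroup.ofCore core

instance : NormedSpace ℂ (LorentzSeq ι r s) := NormedSpace.ofCore core

end LorentzSeq

/-! ### The discrete Fourier transform -/

/-- The torus `𝕋^d = [-π, π]^d` with Lebesgue measure, as a measure on `ℝ^d`. -/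
def torusMeasure (d : ℕ) : Measure (Fin d → ℝ) :=
  volume.restrict (Set.Icc (fun _ => -Real.pi) (fun _ => Real.pi))

/-- The Fourier coefficient `∫_{𝕋^d} f(t) e^{-i⟨t,m⟩} dt`, `m ∈ ℤ^d`. -/
def torusFourierCoeff {d : ℕ} (f : (Fin d → ℝ) → ℂ) (m : Fin d → ℤ) : ℂ :=
  ∫ t, f t * Complex.exp (-Complex.I * ((∑ j, t j * (m j : ℝ) : ℝ) : ℂ)) ∂(torusMeasure d)

section Exponents

variable {p : ℝ} [h1 : Fact (1 < p)]

instance factOneLe : Fact (1 ≤ p) := ⟨h1.out.le⟩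

instance factOneLeOfReal : Fact (1 ≤ ENNReal.ofReal p) :=
  ⟨by simpa using ENNReal.ofReal_le_ofReal h1.out.le⟩

/-- For `1 < p < 2` one has `p ≤ p'`, where `p' = p / (p - 1)`. -/
instance factLeConjExponent [h2 : Fact (p < 2)] : Fact (p ≤ p.conjExponent) :=
  ⟨by
    have h1' := h1.out
    have h2' := h2.out
    rw [Real.conjExponent, le_div_iff₀ (by linarith)]
    nlinarith⟩

end Exponents

end

/-!
Boundedness is Paley's inequality: with `ν` the measure on `ℕ` of mass `(k + 1)⁻²` at `k`, the
`p`-th power of the `l^{p',p}` functional of `c` is `∫ ((k + 1) c*_{k+1})^p dν`. The map taking `f`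
to `k ↦ (k + 1) c*_{k+1}` is of weak type `(1, 1)` because `|c_m| ≤ ‖f‖₁`, and of weak type
`(2, 2)` by Bessel's inequality, so Marcinkiewicz interpolation bounds it on `L^p`.

The transform is bounded below on the closed span of the lacunary blocks
`f_n = 2^{-n/p'} ∑_{2^n ≤ k < 2^{n+1}} e^{ikx}` in one coordinate `x`. Their spectra are disjoint
dyadic blocks, which gives `∑ |a_n|^p ≲ ‖(∑ a_n f_n)^‖_{p',p}^p`. Conversely `|f_n|` is at most
`φ_n = 2^{-n/p'} min(2^n, π/|x|)`, and the Schur test with the weight `|x|^{-1/p}` yields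
`‖∑ a_n f_n‖_p^p ≲ ∑ |a_n|^p`. So the span is a copy of `ℓ^p` on which the transform is an
isomorphism onto its image.
-/

noncomputable section

section Interpolation

lemma lintegral_Ioc_ofReal_rpow {s y : ℝ} (hs : -1 < s) (hy : 0 ≤ y) :
    ∫⁻ τ in Set.Ioc 0 y, ENNReal.ofReal (τ ^ s) = ENNReal.ofReal (y ^ (s + 1) / (s + 1)) := by
  have hint : IntegrableOn (fun τ : ℝ => τ ^ s) (Set.Ioc 0 y) := by
    rw [← intervalIntegrable_iff_integrableOn_Ioc_of_le hy]
    exact intervalIntegral.intervalIntegrable_rpow' hs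
  rw [← ofReal_integral_eq_lintegral_ofReal hint, ← intervalIntegral.integral_of_le hy,
    integral_rpow (Or.inl hs), Real.zero_rpow (by linarith), sub_zero]
  filter_upwards [ae_restrict_mem measurableSet_Ioc] with τ hτ
  exact Real.rpow_nonneg hτ.1.le s

lemma lintegral_Ioi_ofReal_rpow {s y : ℝ} (hs : s < -1) (hy : 0 < y) :
    ∫⁻ τ in Set.Ioi y, ENNReal.ofReal (τ ^ s) = ENNReal.ofReal (-y ^ (s + 1) / (s + 1)) := by
  rw [← ofReal_integral_eq_lintegral_ofReal (integrableOn_Ioi_rpow_of_lt hs hy),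
    integral_Ioi_rpow_of_lt hs hy]
  filter_upwards [ae_restrict_mem measurableSet_Ioi] with τ hτ
  exact Real.rpow_nonneg (hy.trans hτ).le s

variable {α β : Type*} [MeasurableSpace α] [MeasurableSpace β] {μ : Measure α} {ν : Measure β}

lemma lintegral_setLIntegral_swap [SFinite μ] [SFinite ν] {R : α → β → Prop}
    (hR : MeasurableSet {z : α × β | R z.1 z.2}) {g : α → β → ℝ≥0∞}
    (hg : Measurable (Function.uncurry g)) :
    ∫⁻ x, ∫⁻ y in {y | R x y}, g x y ∂ν ∂μ = ∫⁻ y, ∫⁻ x in {x | R x y}, g x y ∂μ ∂ν := by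
  have hx : ∀ x, MeasurableSet {y | R x y} := fun x => measurable_prodMk_left hR
  have hy : ∀ y, MeasurableSet {x | R x y} := fun y => measurable_prodMk_right hR
  simp_rw [← lintegral_indicator (hx _), ← lintegral_indicator (hy _)]
  exact lintegral_lintegral_swap
    (f := fun x y => {z : α × β | R z.1 z.2}.indicator (Function.uncurry g) (x, y))
    (hg.indicator hR).aemeasurable

variable [SFinite μ] {f : α → ℝ}

lemma lintegral_rpow_mul_setLIntegral_ge (hf : Measurable f) (hf0 : ∀ x, 0 ≤ f x) {p q : ℝ}
    (hp : 0 < p) (hqp : q < p) :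
    ∫⁻ τ in Set.Ioi (0 : ℝ), ENNReal.ofReal (τ ^ (p - q - 1)) *
        ∫⁻ x in {x | τ ≤ f x}, ENNReal.ofReal (f x ^ q) ∂μ =
      ENNReal.ofReal (p - q)⁻¹ * ∫⁻ x, ENNReal.ofReal (f x ^ p) ∂μ := by
  simp_rw [← lintegral_const_mul' _ _ ENNReal.ofReal_ne_top]
  rw [lintegral_setLIntegral_swap (R := fun τ x => τ ≤ f x)
    (measurableSet_le measurable_fst (hf.comp measurable_snd)) (by fun_prop)]
  refine lintegral_congr fun x => ?_
  rw [Measure.restrict_restrict (measurableSet_le measurable_id' measurable_const),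
    show {τ : ℝ | τ ≤ f x} ∩ Set.Ioi 0 = Set.Ioc 0 (f x) by
      ext; simp [and_comm],
    lintegral_mul_const' _ _ ENNReal.ofReal_ne_top,
    lintegral_Ioc_ofReal_rpow (by linarith) (hf0 x), sub_add_cancel,
    ← ENNReal.ofReal_mul (by have := hf0 x; have := sub_pos.2 hqp; positivity),
    ← ENNReal.ofReal_mul (inv_nonneg.2 (sub_pos.2 hqp).le)]
  rcases (hf0 x).eq_or_lt with h | h
  · rw [← h, Real.zero_rpow (sub_pos.2 hqp).ne', Real.zero_rpow hp.ne']; simp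
  · rw [div_mul_eq_mul_div, ← Real.rpow_add h, sub_add_cancel, div_eq_inv_mul]

lemma lintegral_rpow_mul_setLIntegral_lt (hf : Measurable f) (hf0 : ∀ x, 0 ≤ f x) {p r : ℝ}
    (hp : 0 < p) (hpr : p < r) :
    ∫⁻ τ in Set.Ioi (0 : ℝ), ENNReal.ofReal (τ ^ (p - r - 1)) *
        ∫⁻ x in {x | f x < τ}, ENNReal.ofReal (f x ^ r) ∂μ =
      ENNReal.ofReal (r - p)⁻¹ * ∫⁻ x, ENNReal.ofReal (f x ^ p) ∂μ := by
  simp_rw [← lintegral_const_mul' _ _ ENNReal.ofReal_ne_top]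
  rw [lintegral_setLIntegral_swap (R := fun τ x => f x < τ)
    (measurableSet_lt (hf.comp measurable_snd) measurable_fst) (by fun_prop)]
  refine lintegral_congr fun x => ?_
  rw [Measure.restrict_restrict (measurableSet_lt measurable_const measurable_id'),
    show {τ : ℝ | f x < τ} ∩ Set.Ioi 0 = Set.Ioi (f x) by
      ext τ; simpa using (hf0 x).trans_lt,
    lintegral_mul_const' _ _ ENNReal.ofReal_ne_top,
    ← ENNReal.ofReal_mul (inv_nonneg.2 (sub_pos.2 hpr).le)]
  rcases (hf0 x).eq_or_lt with h | h
  · rw [← h, Real.zero_rpow (hp.trans hpr).ne', Real.zero_rpow hp.ne']; simp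
  · rw [lintegral_Ioi_ofReal_rpow (by linarith) h, sub_add_cancel, ← neg_div_neg_eq, neg_neg,
      neg_sub, ← ENNReal.ofReal_mul (by have := sub_pos.2 hpr; positivity),
      div_mul_eq_mul_div, ← Real.rpow_add h, sub_add_cancel, div_eq_inv_mul]

lemma lintegral_rpow_le_of_meas_lt_le (hf : Measurable f) (hf0 : ∀ x, 0 ≤ f x) {F : β → ℝ}
    (hF : AEMeasurable F ν) (hF0 : 0 ≤ᵐ[ν] F) {p q r : ℝ} (hp : 0 < p) (hqp : q < p)
    (hpr : p < r) {A B : ℝ≥0∞} (hA : A ≠ ∞) (hB : B ≠ ∞)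
    (h : ∀ τ > 0, ν {y | τ < F y} ≤
      A * (ENNReal.ofReal (τ ^ (-q)) * ∫⁻ x in {x | τ ≤ f x}, ENNReal.ofReal (f x ^ q) ∂μ) +
      B * (ENNReal.ofReal (τ ^ (-r)) * ∫⁻ x in {x | f x < τ}, ENNReal.ofReal (f x ^ r) ∂μ)) :
    ∫⁻ y, ENNReal.ofReal (F y ^ p) ∂ν ≤
      ENNReal.ofReal p * (A * ENNReal.ofReal (p - q)⁻¹ + B * ENNReal.ofReal (r - p)⁻¹) *
        ∫⁻ x, ENNReal.ofReal (f x ^ p) ∂μ := by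
  rw [lintegral_rpow_eq_lintegral_meas_lt_mul ν hF0 hF hp, mul_assoc]
  gcongr
  have hmeas : Measurable fun τ => ∫⁻ x in {x | τ ≤ f x}, ENNReal.ofReal (f x ^ q) ∂μ :=
    Antitone.measurable fun _ _ hτ => lintegral_mono_set fun _ hx => hτ.trans hx
  rw [add_mul, mul_assoc, mul_assoc, ← lintegral_rpow_mul_setLIntegral_ge hf hf0 hp hqp,
    ← lintegral_rpow_mul_setLIntegral_lt hf hf0 hp hpr, ← lintegral_const_mul' _ _ hA,
    ← lintegral_const_mul' _ _ hB, ← lintegral_add_left (by fun_prop)]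
  refine setLIntegral_mono' measurableSet_Ioi fun τ (hτ : 0 < τ) => ?_
  have hpow (s : ℝ) : ENNReal.ofReal (τ ^ (p - s - 1)) =
      ENNReal.ofReal (τ ^ (-s)) * ENNReal.ofReal (τ ^ (p - 1)) := by
    rw [← ENNReal.ofReal_mul (by positivity), ← Real.rpow_add hτ]
    ring_nf
  refine (mul_le_mul_left (h τ hτ) _).trans_eq ?_
  rw [hpow, hpow]
  ring

end Interpolation

namespace Lorentz

variable {ι : Type*}

lemma rearr_add_le_of_enorm_le {a : ι → ℂ} {H : ℝ≥0∞} (ha : ∀ m, ‖a m‖ₑ ≤ H) (b : ι → ℂ)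
    (k : ℕ) : rearr (a + b) k ≤ H + rearr b k := by
  rw [rearr, rearr, ENNReal.add_sInf]
  refine le_iInf₂ fun τ hτ => sInf_le ((Set.encard_le_encard fun m hm => ?_).trans hτ)
  by_contra hle
  exact (Set.mem_ofPred.1 hm).not_ge ((enorm_add_le _ _).trans (add_le_add (ha m) (not_lt.1 hle)))

lemma succ_mul_rearr_rpow_le {b : ι → ℂ} {q : ℝ} (hq : 0 < q) {B : ℝ≥0∞}
    (hB : ∀ A : Finset ι, ∑ m ∈ A, ‖b m‖ₑ ^ q ≤ B) (k : ℕ) :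
    ((k : ℝ≥0∞) + 1) * rearr b k ^ q ≤ B := by
  suffices h : rearr b k ≤ (B / ((k : ℝ≥0∞) + 1)) ^ q⁻¹ by
    rw [ENNReal.le_rpow_inv_iff hq] at h
    exact ENNReal.mul_le_of_le_div' h
  refine sInf_le (Set.mem_ofPred.2 (le_of_not_gt fun hk => ?_))
  obtain ⟨S, hS, hcard⟩ := Set.exists_subset_encard_eq (Order.add_one_le_of_lt hk)
  have hfin : S.Finite := Set.finite_of_encard_eq_coe (k := k + 1) (by exact_mod_cast hcard)
  lift S to Finset ι using hfin
  rw [Set.encard_coe_eq_coe_finsetCard] at hcard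
  have hcard' : S.card = k + 1 := by exact_mod_cast hcard
  have hlt : ∑ _m ∈ S, B / ((k : ℝ≥0∞) + 1) < ∑ m ∈ S, ‖b m‖ₑ ^ q :=
    ENNReal.sum_lt_sum_of_nonempty (Finset.card_pos.1 (by omega)) fun m hm =>
      (ENNReal.rpow_inv_lt_iff hq).1 (hS hm)
  refine hlt.not_ge ((hB S).trans_eq ?_)
  rw [Finset.sum_const, hcard', nsmul_eq_mul, Nat.cast_succ,
    ENNReal.mul_div_cancel (by simp) (by simp)]

end Lorentz

/-- The measure `∑ k, (k + 1)⁻² δ_k`, with respect to which `c ↦ ((k + 1) c*_{k+1})_k` is of weak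
type both on bounded and on square summable families. -/
def paleyMeasure : Measure ℕ :=
  Measure.count.withDensity fun k : ℕ => ((k : ℝ≥0∞) + 1) ^ (-2 : ℝ)

lemma lintegral_paleyMeasure (g : ℕ → ℝ≥0∞) :
    ∫⁻ k, g k ∂paleyMeasure = ∑' k : ℕ, ((k : ℝ≥0∞) + 1) ^ (-2 : ℝ) * g k := by
  rw [paleyMeasure, lintegral_withDensity_eq_lintegral_mul _ (by fun_prop) (by fun_prop),
    lintegral_count]
  rfl

lemma paleyMeasure_Ici_le (N : ℕ) : paleyMeasure (Set.Ici N) ≤ 2 / ((N : ℝ≥0∞) + 1) := by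
  have hterm (k : ℕ) : ((k : ℝ≥0∞) + 1) ^ (-2 : ℝ) =
      ENNReal.ofReal ((((k + 1 : ℕ) : ℝ) ^ 2)⁻¹) := by
    rw [ENNReal.ofReal_inv_of_pos (by positivity), ENNReal.ofReal_pow (by positivity),
      ENNReal.ofReal_natCast, ENNReal.rpow_neg]
    norm_cast
  rw [← lintegral_indicator_one measurableSet_Ici, lintegral_paleyMeasure]
  refine ENNReal.tsum_le_of_sum_range_le fun n => ?_
  calc ∑ k ∈ Finset.range n, ((k : ℝ≥0∞) + 1) ^ (-2 : ℝ) * (Set.Ici N).indicator 1 k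
      = ∑ k ∈ Finset.range n with N ≤ k, ENNReal.ofReal ((((k + 1 : ℕ) : ℝ) ^ 2)⁻¹) := by
        rw [Finset.sum_filter]
        refine Finset.sum_congr rfl fun k _ => ?_
        rw [hterm, Set.indicator_apply]
        simp
    _ = ENNReal.ofReal (∑ i ∈ Finset.Ioo N (n + 1), ((i : ℝ) ^ 2)⁻¹) := by
        rw [← ENNReal.ofReal_sum_of_nonneg fun _ _ => by positivity]
        congr 1
        refine Finset.sum_nbij' (· + 1) (· - 1) ?_ ?_ ?_ ?_ ?_ <;> simp <;> omega
    _ ≤ ENNReal.ofReal (2 / (N + 1)) := ENNReal.ofReal_le_ofReal (sum_Ioo_inv_sq_le _ _)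
    _ = 2 / ((N : ℝ≥0∞) + 1) := by
        rw [ENNReal.ofReal_div_of_pos (by positivity), ENNReal.ofReal_add (by positivity) (by simp)]
        simp

lemma paleyMeasure_lt_mul_le {s H : ℝ≥0∞} (hs : s ≠ ∞) :
    paleyMeasure {k | s < ((k : ℝ≥0∞) + 1) * H} ≤ 2 * (H / s) := by
  rcases eq_or_ne H ∞ with rfl | hH
  · simp [ENNReal.top_div, hs, ENNReal.mul_top]
  rcases eq_or_ne H 0 with rfl | hH0
  · simp
  have hfin : s / H ≠ ∞ := ENNReal.div_ne_top hs hH0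
  have hsub : {k : ℕ | s < ((k : ℝ≥0∞) + 1) * H} ⊆ Set.Ici ⌊(s / H).toReal⌋₊ := by
    intro k hk
    have hlt : s / H < ((k + 1 : ℕ) : ℝ≥0∞) := by
      push_cast; exact ENNReal.div_lt_of_lt_mul hk
    rw [← ENNReal.ofReal_toReal hfin, ENNReal.ofReal_lt_natCast (by omega)] at hlt
    exact Nat.lt_succ_iff.1 ((Nat.floor_lt ENNReal.toReal_nonneg).2 hlt)
  have hfloor : s / H ≤ (⌊(s / H).toReal⌋₊ : ℝ≥0∞) + 1 := by
    rw [← ENNReal.toReal_le_toReal hfin (by simp)]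
    simpa [ENNReal.toReal_add] using (Nat.lt_floor_add_one (s / H).toReal).le
  calc paleyMeasure {k | s < ((k : ℝ≥0∞) + 1) * H}
      ≤ 2 / ((⌊(s / H).toReal⌋₊ : ℝ≥0∞) + 1) := (measure_mono hsub).trans (paleyMeasure_Ici_le _)
    _ ≤ 2 / (s / H) := ENNReal.div_le_div_left hfloor 2
    _ = 2 * (H / s) := by rw [div_eq_mul_inv, ENNReal.inv_div (Or.inl hH) (Or.inl hH0)]

lemma paleyMeasure_lt_mul_rearr_le {ι : Type*} {a b : ι → ℂ} {H B : ℝ≥0∞}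
    (ha : ∀ m, ‖a m‖ₑ ≤ H) (hb : ∀ A : Finset ι, ∑ m ∈ A, ‖b m‖ₑ ^ (2 : ℝ) ≤ B) {τ : ℝ≥0∞}
    (hτ : τ ≠ ∞) :
    paleyMeasure {k | τ < ((k : ℝ≥0∞) + 1) * Lorentz.rearr (a + b) k} ≤
      4 * (H / τ) + 8 * (B / τ ^ (2 : ℝ)) := by
  have h2 : τ / 2 ≠ ∞ := ENNReal.div_ne_top hτ (by simp)
  have hsub : {k : ℕ | τ < ((k : ℝ≥0∞) + 1) * Lorentz.rearr (a + b) k} ⊆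
      {k : ℕ | τ / 2 < ((k : ℝ≥0∞) + 1) * H} ∪
        {k : ℕ | (τ / 2) ^ (2 : ℝ) < ((k : ℝ≥0∞) + 1) * B} := by
    intro k hk
    by_contra! hnot
    obtain ⟨hH, hB⟩ : ((k : ℝ≥0∞) + 1) * H ≤ τ / 2 ∧
        ((k : ℝ≥0∞) + 1) * B ≤ (τ / 2) ^ (2 : ℝ) := by simpa using hnot
    have hsq : ((k : ℝ≥0∞) + 1) * Lorentz.rearr b k ≤ τ / 2 := by
      rw [← ENNReal.rpow_le_rpow_iff two_pos, ENNReal.mul_rpow_of_nonneg _ _ two_pos.le]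
      refine le_trans (le_of_eq ?_)
        ((mul_le_mul_right (Lorentz.succ_mul_rearr_rpow_le two_pos hb k) _).trans hB)
      rw [ENNReal.rpow_two, sq, mul_assoc]
    refine (Set.mem_ofPred.1 hk).not_ge ?_
    calc ((k : ℝ≥0∞) + 1) * Lorentz.rearr (a + b) k
        ≤ ((k : ℝ≥0∞) + 1) * (H + Lorentz.rearr b k) := by
          gcongr; exact Lorentz.rearr_add_le_of_enorm_le ha b k
      _ ≤ τ / 2 + τ / 2 := by rw [mul_add]; gcongr
      _ = τ := ENNReal.add_halves τ
  calc paleyMeasure {k : ℕ | τ < ((k : ℝ≥0∞) + 1) * Lorentz.rearr (a + b) k}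
      ≤ 2 * (H / (τ / 2)) + 2 * (B / (τ / 2) ^ (2 : ℝ)) :=
        (measure_mono hsub).trans ((measure_union_le _ _).trans (add_le_add
          (paleyMeasure_lt_mul_le h2) (paleyMeasure_lt_mul_le (by simp [h2]))))
    _ = 4 * (H / τ) + 8 * (B / τ ^ (2 : ℝ)) := by
        have h4 : (2 : ℝ≥0∞) * 2 ^ (2 : ℝ) = 8 := by norm_num
        rw [ENNReal.div_rpow_of_nonneg _ _ two_pos.le, div_eq_mul_inv H, div_eq_mul_inv B,
          ENNReal.inv_div (by simp) (by simp), ENNReal.inv_div (by simp) (by simp), ← h4]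
        simp only [div_eq_mul_inv]
        ring

lemma Lorentz.eNorm_conjExponent_rpow {ι : Type*} {p : ℝ} (hp : 1 < p) (c : ι → ℂ) :
    Lorentz.eNorm p.conjExponent p c ^ p =
      ∫⁻ k, (((k : ℝ≥0∞) + 1) * Lorentz.rearr c k) ^ p ∂paleyMeasure := by
  have hp0 : 0 < p := one_pos.trans hp
  have hexp : (1 / p.conjExponent - 1 / p) * p = -2 + p := by
    rw [Real.conjExponent]
    have := sub_pos.2 hp
    field_simp
    ring
  rw [Lorentz.eNorm, ← ENNReal.rpow_mul, one_div_mul_cancel hp0.ne', ENNReal.rpow_one,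
    lintegral_paleyMeasure]
  refine tsum_congr fun k => ?_
  rw [ENNReal.mul_rpow_of_nonneg _ _ hp0.le, ENNReal.mul_rpow_of_nonneg _ _ hp0.le,
    Lorentz.weight, ← ENNReal.rpow_mul, hexp, ENNReal.rpow_add _ _ (by simp) (by simp), mul_assoc]

lemma ofReal_norm_rpow {E : Type*} [SeminormedAddGroup E] (x : E) {q : ℝ} (hq : 0 ≤ q) :
    ENNReal.ofReal (‖x‖ ^ q) = ‖x‖ₑ ^ q := by
  rw [← ENNReal.ofReal_rpow_of_nonneg (norm_nonneg x) hq, ofReal_norm]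

section Paley

variable {α ι : Type*} [MeasurableSpace α] {μ : Measure α} {χ : ι → α → ℂ}

lemma enorm_integral_mul_le (hχ1 : ∀ m t, ‖χ m t‖ ≤ 1) (f : α → ℂ) (m : ι) :
    ‖∫ t, f t * χ m t ∂μ‖ₑ ≤ ∫⁻ t, ‖f t‖ₑ ∂μ := by
  refine (enorm_integral_le_lintegral_enorm _).trans (lintegral_mono fun t => ?_)
  rw [enorm_mul]
  refine mul_le_of_le_one_right' ?_
  rw [← ofReal_norm, ENNReal.ofReal_le_one]
  exact hχ1 m t

variable [IsFiniteMeasure μ] {M : ℝ≥0∞}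

lemma paleyMeasure_lt_mul_rearr_integral_le (hχ : ∀ m, AEStronglyMeasurable (χ m) μ)
    (hχ1 : ∀ m t, ‖χ m t‖ ≤ 1)
    (hBessel : ∀ g : α → ℂ, MemLp g 2 μ → ∀ A : Finset ι,
      ∑ m ∈ A, ‖∫ t, g t * χ m t ∂μ‖ₑ ^ (2 : ℝ) ≤ M * ∫⁻ t, ‖g t‖ₑ ^ (2 : ℝ) ∂μ)
    {f : α → ℂ} (hf : Measurable f) (hfi : Integrable f μ) {τ : ℝ} (hτ : 0 < τ) :
    paleyMeasure {k | ENNReal.ofReal τ <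
        ((k : ℝ≥0∞) + 1) * Lorentz.rearr (fun m => ∫ t, f t * χ m t ∂μ) k} ≤
      4 * (ENNReal.ofReal (τ ^ (-1 : ℝ)) * ∫⁻ t in {t | τ ≤ ‖f t‖}, ‖f t‖ₑ ∂μ) +
      8 * M * (ENNReal.ofReal (τ ^ (-2 : ℝ)) *
        ∫⁻ t in {t | ‖f t‖ < τ}, ‖f t‖ₑ ^ (2 : ℝ) ∂μ) := by
  set S : Set α := {t | τ ≤ ‖f t‖}
  have hS : MeasurableSet S := measurableSet_le measurable_const hf.norm
  have hSc : {t | ‖f t‖ < τ} = Sᶜ := by ext; simp [S]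
  have hlow : MemLp (Sᶜ.indicator f) 2 μ := by
    refine MemLp.of_bound (hf.indicator hS.compl).aestronglyMeasurable τ (.of_forall fun t => ?_)
    rw [norm_indicator_eq_indicator_norm]
    refine Set.indicator_apply_le' (fun ht => ?_) fun _ => hτ.le
    exact (Set.mem_ofPred.1 (hSc ▸ ht)).le
  have hint (R : Set α) (hR : MeasurableSet R) (m : ι) :
      Integrable (fun t => R.indicator f t * χ m t) μ :=
    (hfi.indicator hR).mul_bdd (c := 1) (hχ m) (.of_forall (hχ1 m))
  have hsplit : (fun m => ∫ t, f t * χ m t ∂μ) =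
      (fun m => ∫ t, S.indicator f t * χ m t ∂μ) + fun m => ∫ t, Sᶜ.indicator f t * χ m t ∂μ := by
    funext m
    rw [Pi.add_apply, ← integral_add (hint S hS m) (hint Sᶜ hS.compl m)]
    simp_rw [← add_mul, ← Pi.add_apply (S.indicator f), Set.indicator_self_add_compl]
  have hhigh : ∫⁻ t, ‖S.indicator f t‖ₑ ∂μ = ∫⁻ t in S, ‖f t‖ₑ ∂μ := by
    simp_rw [enorm_indicator_eq_indicator_enorm, lintegral_indicator hS]
  have hlow' : ∫⁻ t, ‖Sᶜ.indicator f t‖ₑ ^ (2 : ℝ) ∂μ = ∫⁻ t in Sᶜ, ‖f t‖ₑ ^ (2 : ℝ) ∂μ := by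
    rw [← lintegral_indicator hS.compl]
    refine lintegral_congr fun t => ?_
    by_cases ht : t ∈ Sᶜ <;> simp [ht]
  rw [hsplit, hSc]
  refine (paleyMeasure_lt_mul_rearr_le (enorm_integral_mul_le hχ1 _) (hBessel _ hlow)
    ENNReal.ofReal_ne_top).trans_eq ?_
  rw [hhigh, hlow', Real.rpow_neg hτ.le, Real.rpow_neg hτ.le, Real.rpow_one,
    ENNReal.ofReal_inv_of_pos hτ, ENNReal.ofReal_inv_of_pos (by positivity),
    ← ENNReal.ofReal_rpow_of_pos hτ]
  simp only [div_eq_mul_inv]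
  ring

theorem Lorentz.eNorm_integral_mul_rpow_le (hχ : ∀ m, AEStronglyMeasurable (χ m) μ)
    (hχ1 : ∀ m t, ‖χ m t‖ ≤ 1) (hM : M ≠ ∞)
    (hBessel : ∀ g : α → ℂ, MemLp g 2 μ → ∀ A : Finset ι,
      ∑ m ∈ A, ‖∫ t, g t * χ m t ∂μ‖ₑ ^ (2 : ℝ) ≤ M * ∫⁻ t, ‖g t‖ₑ ^ (2 : ℝ) ∂μ)
    {p : ℝ} (h1 : 1 < p) (h2 : p < 2) {f : α → ℂ} (hf : Measurable f) (hfi : Integrable f μ) :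
    Lorentz.eNorm p.conjExponent p (fun m => ∫ t, f t * χ m t ∂μ) ^ p ≤
      ENNReal.ofReal p *
          (4 * ENNReal.ofReal (p - 1)⁻¹ + 8 * M * ENNReal.ofReal (2 - p)⁻¹) *
        ∫⁻ t, ‖f t‖ₑ ^ p ∂μ := by
  have hp : 0 < p := one_pos.trans h1
  set c : ι → ℂ := fun m => ∫ t, f t * χ m t ∂μ
  have hfin (k : ℕ) : ((k : ℝ≥0∞) + 1) * Lorentz.rearr c k ≠ ∞ := by
    refine ENNReal.mul_ne_top (by simp) (ne_top_of_le_ne_top hfi.2.ne ?_)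
    exact (Lorentz.rearr_antitone c k.zero_le).trans
      (Lorentz.rearr_zero_le (enorm_integral_mul_le hχ1 f))
  have h := lintegral_rpow_le_of_meas_lt_le (μ := μ) (ν := paleyMeasure)
    (F := fun k => (((k : ℝ≥0∞) + 1) * Lorentz.rearr c k).toReal) hf.norm (fun _ => norm_nonneg _)
    (by fun_prop) (.of_forall fun _ => ENNReal.toReal_nonneg) hp h1 h2
    (A := 4) (B := 8 * M) (by simp) (ENNReal.mul_ne_top (by simp) hM) fun τ hτ => by
      simp_rw [← ENNReal.ofReal_lt_iff_lt_toReal hτ.le (hfin _),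
        ofReal_norm_rpow _ zero_le_one, ofReal_norm_rpow _ zero_le_two, ENNReal.rpow_one]
      exact paleyMeasure_lt_mul_rearr_integral_le hχ hχ1 hBessel hf hfi hτ
  rw [Lorentz.eNorm_conjExponent_rpow h1]
  simpa only [← ENNReal.ofReal_rpow_of_nonneg ENNReal.toReal_nonneg hp.le,
    ENNReal.ofReal_toReal (hfin _), ofReal_norm_rpow _ hp.le] using h

end Paley

section Bessel

variable {α ι : Type*} [MeasurableSpace α] {μ : Measure α}

lemma inner_toLp_star {f g : α → ℂ} (hf : MemLp f 2 μ) (hg : MemLp g 2 μ) :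
    inner ℂ (hf.star.toLp (star f)) (hg.toLp g) = ∫ t, g t * f t ∂μ := by
  rw [L2.inner_def]
  refine integral_congr_ae ?_
  filter_upwards [hf.star.coeFn_toLp, hg.coeFn_toLp] with t htf htg
  rw [htf, htg, RCLike.inner_apply]
  simp

lemma ofReal_norm_toLp_sq {g : α → ℂ} (hg : MemLp g 2 μ) :
    ENNReal.ofReal (‖hg.toLp g‖ ^ 2) = ∫⁻ t, ‖g t‖ₑ ^ (2 : ℝ) ∂μ := by
  rw [Lp.norm_toLp, ENNReal.ofReal_pow ENNReal.toReal_nonneg,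
    ENNReal.ofReal_toReal hg.eLpNorm_ne_top,
    eLpNorm_eq_lintegral_rpow_enorm_toReal (by simp) (by simp), ← ENNReal.rpow_natCast,
    ← ENNReal.rpow_mul]
  simp

lemma enorm_Lp_rpow {p : ℝ} (hp : 0 < p) (f : Lp ℂ (ENNReal.ofReal p) μ) :
    ‖f‖ₑ ^ p = ∫⁻ t, ‖f t‖ₑ ^ p ∂μ := by
  rw [Lp.enorm_def, eLpNorm_eq_lintegral_rpow_enorm_toReal (by simpa using hp) (by simp),
    ENNReal.toReal_ofReal hp.le, ← ENNReal.rpow_mul, one_div_mul_cancel hp.ne', ENNReal.rpow_one]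

lemma sum_enorm_integral_mul_rpow_two_le [DecidableEq ι] {χ : ι → α → ℂ}
    (hχ : ∀ m, MemLp (χ m) 2 μ) {M : ℝ} (hM : 0 < M)
    (horth : ∀ m n, ∫ t, χ m t * star (χ n t) ∂μ = if m = n then (M : ℂ) else 0) {g : α → ℂ}
    (hg : MemLp g 2 μ) (A : Finset ι) :
    ∑ m ∈ A, ‖∫ t, g t * χ m t ∂μ‖ₑ ^ (2 : ℝ) ≤
      ENNReal.ofReal M * ∫⁻ t, ‖g t‖ₑ ^ (2 : ℝ) ∂μ := by
  set u : ι → Lp ℂ 2 μ := fun m => (√M : ℂ)⁻¹ • (hχ m).star.toLp (star (χ m)) with hu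
  have hsqrt : (√M : ℂ)⁻¹ * (√M : ℂ)⁻¹ * M = 1 := by
    rw [← mul_inv, ← Complex.ofReal_mul, Real.mul_self_sqrt hM.le, inv_mul_cancel₀]
    exact_mod_cast hM.ne'
  have horthonormal : Orthonormal ℂ u := by
    refine orthonormal_iff_ite.2 fun m n => ?_
    rw [hu, inner_smul_left, inner_smul_right, inner_toLp_star (hχ m) (hχ n).star, map_inv₀,
      Complex.conj_ofReal, ← mul_assoc]
    simp_rw [Pi.star_apply, mul_comm (star _)]
    rw [horth]
    simp only [mul_ite, hsqrt, mul_zero]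
  have hinner (m : ι) : ‖inner ℂ (u m) (hg.toLp g)‖ ^ 2 = M⁻¹ * ‖∫ t, g t * χ m t ∂μ‖ ^ 2 := by
    rw [hu, inner_smul_left, inner_toLp_star (hχ m) hg, norm_mul, mul_pow, RCLike.norm_conj,
      norm_inv, Complex.norm_real, Real.norm_of_nonneg (Real.sqrt_nonneg M), inv_pow,
      Real.sq_sqrt hM.le]
  have hBessel := horthonormal.sum_inner_products_le (hg.toLp g) (s := A)
  simp_rw [hinner] at hBessel
  rw [← Finset.mul_sum, inv_mul_le_iff₀ hM] at hBessel
  calc ∑ m ∈ A, ‖∫ t, g t * χ m t ∂μ‖ₑ ^ (2 : ℝ)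
      = ENNReal.ofReal (∑ m ∈ A, ‖∫ t, g t * χ m t ∂μ‖ ^ 2) := by
        rw [ENNReal.ofReal_sum_of_nonneg fun _ _ => by positivity]
        simp_rw [← Real.rpow_two, ofReal_norm_rpow _ zero_le_two]
    _ ≤ ENNReal.ofReal (M * ‖hg.toLp g‖ ^ 2) := ENNReal.ofReal_le_ofReal hBessel
    _ = ENNReal.ofReal M * ∫⁻ t, ‖g t‖ₑ ^ (2 : ℝ) ∂μ := by
        rw [ENNReal.ofReal_mul hM.le, ofReal_norm_toLp_sq]

end Bessel

section Torus

variable {d : ℕ}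

instance isFiniteMeasure_torusMeasure : IsFiniteMeasure (torusMeasure d) := by
  unfold torusMeasure
  exact ⟨by simpa using (isCompact_Icc (a := fun _ : Fin d => -Real.pi)).measure_lt_top⟩

lemma torusMeasure_eq_pi : torusMeasure d =
    Measure.pi fun _ : Fin d => (volume : Measure ℝ).restrict (Set.Icc (-Real.pi) Real.pi) := by
  rw [torusMeasure, ← Set.pi_univ_Icc, volume_pi, Measure.restrict_pi_pi]

/-- The character `t ↦ e^{-i⟨t,m⟩}`. -/
def torusChar (m : Fin d → ℤ) (t : Fin d → ℝ) : ℂ :=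
  Complex.exp (-Complex.I * ((∑ j, t j * (m j : ℝ) : ℝ) : ℂ))

lemma continuous_torusChar (m : Fin d → ℤ) : Continuous (torusChar m) := by
  unfold torusChar; fun_prop

lemma norm_torusChar (m : Fin d → ℤ) (t : Fin d → ℝ) : ‖torusChar m t‖ = 1 := by
  rw [torusChar, neg_mul, ← mul_neg, ← Complex.ofReal_neg, Complex.norm_exp_I_mul_ofReal]

lemma memLp_torusChar (m : Fin d → ℤ) (q : ℝ≥0∞) : MemLp (torusChar m) q (torusMeasure d) :=
  .of_bound (continuous_torusChar m).aestronglyMeasurable 1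
    (.of_forall fun t => (norm_torusChar m t).le)

lemma torusChar_mul_star (m n : Fin d → ℤ) (t : Fin d → ℝ) :
    torusChar m t * star (torusChar n t) = torusChar (m - n) t := by
  simp only [torusChar, Complex.star_def, ← Complex.exp_conj, ← Complex.exp_add, map_mul, map_neg,
    Complex.conj_I, Complex.conj_ofReal, Pi.sub_apply]
  push_cast
  simp only [mul_sub, Finset.sum_sub_distrib]
  ring_nf

lemma integral_exp_int_mul {n : ℤ} (hn : n ≠ 0) :
    ∫ x in Set.Icc (-Real.pi) Real.pi, Complex.exp (-Complex.I * n * x) = 0 := by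
  rw [integral_Icc_eq_integral_Ioc, ← intervalIntegral.integral_of_le (by linarith [Real.pi_pos]),
    integral_exp_mul_complex (by simp [hn])]
  have hperiod : Complex.exp (-Complex.I * n * (Real.pi : ℝ)) =
      Complex.exp (-Complex.I * n * ((-Real.pi : ℝ) : ℂ)) :=
    Complex.exp_eq_exp_iff_exists_int.2 ⟨-n, by push_cast; ring⟩
  rw [hperiod, sub_self, zero_div]

lemma integral_torusChar {m : Fin d → ℤ} (hm : m ≠ 0) :
    ∫ t, torusChar m t ∂(torusMeasure d) = 0 := by
  have hprod (t : Fin d → ℝ) : torusChar m t = ∏ j, Complex.exp (-Complex.I * m j * t j) := by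
    rw [torusChar, ← Complex.exp_sum, Complex.ofReal_sum, Finset.mul_sum]
    congr 1
    exact Finset.sum_congr rfl fun j _ => by push_cast; ring
  obtain ⟨j, hj⟩ := Function.ne_iff.1 hm
  simp_rw [hprod, torusMeasure_eq_pi]
  rw [integral_fintype_prod_eq_prod (f := fun j (x : ℝ) => Complex.exp (-Complex.I * m j * x))]
  exact Finset.prod_eq_zero (Finset.mem_univ j) (integral_exp_int_mul hj)

lemma torusMeasure_real_univ_pos : 0 < (torusMeasure d).real Set.univ := by
  have hside : 0 < (ENNReal.ofReal (Real.pi + Real.pi)).toReal :=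
    ENNReal.toReal_pos (by simp [Real.pi_pos]) ENNReal.ofReal_ne_top
  rw [measureReal_def, torusMeasure_eq_pi, Measure.pi_univ]
  simp [hside]

lemma integral_torusChar_mul_star (m n : Fin d → ℤ) :
    ∫ t, torusChar m t * star (torusChar n t) ∂(torusMeasure d) =
      if m = n then ((torusMeasure d).real Set.univ : ℂ) else 0 := by
  simp_rw [torusChar_mul_star]
  split_ifs with h
  · simp [h, torusChar]
  · exact integral_torusChar (sub_ne_zero.2 h)

lemma torusFourierCoeff_eq (f : (Fin d → ℝ) → ℂ) (m : Fin d → ℤ) :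
    torusFourierCoeff f m = ∫ t, f t * torusChar m t ∂(torusMeasure d) := rfl

lemma torusFourierCoeff_add {f g : (Fin d → ℝ) → ℂ} (hf : Integrable f (torusMeasure d))
    (hg : Integrable g (torusMeasure d)) :
    torusFourierCoeff (f + g) = torusFourierCoeff f + torusFourierCoeff g := by
  have hint {h : (Fin d → ℝ) → ℂ} (hh : Integrable h (torusMeasure d)) (m : Fin d → ℤ) :
      Integrable (fun t => h t * torusChar m t) (torusMeasure d) :=
    hh.mul_bdd (continuous_torusChar m).aestronglyMeasurable
      (.of_forall fun t => (norm_torusChar m t).le)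
  funext m
  simp only [torusFourierCoeff_eq, Pi.add_apply, add_mul]
  exact integral_add (hint hf m) (hint hg m)

lemma torusFourierCoeff_smul (a : ℂ) (f : (Fin d → ℝ) → ℂ) :
    torusFourierCoeff (a • f) = a • torusFourierCoeff f := by
  funext m
  simp only [torusFourierCoeff_eq, Pi.smul_apply, smul_eq_mul, mul_assoc]
  exact integral_const_mul _ _

lemma torusFourierCoeff_congr {f g : (Fin d → ℝ) → ℂ} (h : f =ᵐ[torusMeasure d] g) :
    torusFourierCoeff f = torusFourierCoeff g :=
  funext fun _ => integral_congr_ae (h.mono fun t ht => by simp only [ht])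

variable {p : ℝ}

lemma torusFourierCoeff_Lp_add [Fact (1 < p)] (f g : Lp ℂ (ENNReal.ofReal p) (torusMeasure d)) :
    torusFourierCoeff (f + g : Lp ℂ (ENNReal.ofReal p) (torusMeasure d)) =
      torusFourierCoeff f + torusFourierCoeff g := by
  rw [torusFourierCoeff_congr (Lp.coeFn_add f g), torusFourierCoeff_add] <;>
    exact (Lp.memLp _).integrable factOneLeOfReal.out

lemma torusFourierCoeff_Lp_smul (a : ℂ) (f : Lp ℂ (ENNReal.ofReal p) (torusMeasure d)) :
    torusFourierCoeff (a • f : Lp ℂ (ENNReal.ofReal p) (torusMeasure d)) =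
      a • torusFourierCoeff f := by
  rw [torusFourierCoeff_congr (Lp.coeFn_smul a f), torusFourierCoeff_smul]

lemma exists_eNorm_torusFourierCoeff_le (d : ℕ) (p : ℝ) [h1 : Fact (1 < p)] [h2 : Fact (p < 2)] :
    ∃ C : NNReal, ∀ f : Lp ℂ (ENNReal.ofReal p) (torusMeasure d),
      Lorentz.eNorm p.conjExponent p (torusFourierCoeff f) ≤ C * ‖f‖ₑ := by
  have hp : 0 < p := one_pos.trans h1.out
  set M : ℝ≥0∞ := ENNReal.ofReal ((torusMeasure d).real Set.univ)
  set K : ℝ≥0∞ := ENNReal.ofReal p *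
    (4 * ENNReal.ofReal (p - 1)⁻¹ + 8 * M * ENNReal.ofReal (2 - p)⁻¹)
  have hK : K ≠ ∞ := by finiteness
  refine ⟨(K ^ p⁻¹).toNNReal, fun f => ?_⟩
  rw [ENNReal.coe_toNNReal (by finiteness), ← ENNReal.rpow_le_rpow_iff hp,
    ENNReal.mul_rpow_of_nonneg _ _ hp.le, ENNReal.rpow_inv_rpow hp.ne', enorm_Lp_rpow hp]
  refine Lorentz.eNorm_integral_mul_rpow_le (χ := torusChar)
    (fun m => (continuous_torusChar m).aestronglyMeasurable) (fun m t => (norm_torusChar m t).le)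
    ENNReal.ofReal_ne_top (fun g hg A => ?_) h1.out h2.out
    (Lp.stronglyMeasurable f).measurable ((Lp.memLp f).integrable factOneLeOfReal.out)
  exact sum_enorm_integral_mul_rpow_two_le (fun m => memLp_torusChar m 2)
    torusMeasure_real_univ_pos integral_torusChar_mul_star hg A

lemma eNorm_torusFourierCoeff_lt_top [Fact (1 < p)] [Fact (p < 2)]
    (f : Lp ℂ (ENNReal.ofReal p) (torusMeasure d)) :
    Lorentz.eNorm p.conjExponent p (torusFourierCoeff f) < ∞ := by
  obtain ⟨C, hC⟩ := exists_eNorm_torusFourierCoeff_le d p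
  exact (hC f).trans_lt (by finiteness)

/-- The discrete Fourier transform `L^p(𝕋^d) → l^{p',p}(ℤ^d)`. -/
def torusFourier (d : ℕ) (p : ℝ) [Fact (1 < p)] [Fact (p < 2)] :
    Lp ℂ (ENNReal.ofReal p) (torusMeasure d) →L[ℂ] LorentzSeq (Fin d → ℤ) p.conjExponent p :=
  LinearMap.mkContinuousOfExistsBound
    { toFun := fun f => ⟨torusFourierCoeff f, eNorm_torusFourierCoeff_lt_top f⟩
      map_add' := fun f g => Subtype.ext (torusFourierCoeff_Lp_add f g)
      map_smul' := fun a f => Subtype.ext (torusFourierCoeff_Lp_smul a f) } <| by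
    obtain ⟨C, hC⟩ := exists_eNorm_torusFourierCoeff_le d p
    refine ⟨C, fun f => ENNReal.toReal_le_of_le_ofReal (by positivity) ((hC f).trans_eq ?_)⟩
    rw [ENNReal.ofReal_mul (by positivity), ofReal_norm, ENNReal.ofReal_coe_nnreal]

lemma torusFourier_apply [Fact (1 < p)] [Fact (p < 2)]
    (f : Lp ℂ (ENNReal.ofReal p) (torusMeasure d)) (m : Fin d → ℤ) :
    torusFourier d p f m = torusFourierCoeff f m := rfl

end Torus

section NotStrictlySingular

variable {X Y ι : Type*} [NormedAddCommGroup X] [NormedSpace ℂ X] [NormedAddCommGroup Y]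
  [NormedSpace ℂ Y] {T : X →L[ℂ] Y} [Infinite ι] {f : ι → X}

lemma not_strictlySingular_of_norm_le (hf : LinearIndependent ℂ f) {C : NNReal}
    (hC : ∀ x ∈ Submodule.span ℂ (Set.range f), ‖x‖ ≤ C * ‖T x‖) : ¬ StrictlySingular T := by
  intro hT
  set E := (Submodule.span ℂ (Set.range f)).topologicalClosure
  have hE : ¬ FiniteDimensional ℂ E := fun _ =>
    have := Submodule.finiteDimensional_of_le (Submodule.le_topologicalClosure
      (Submodule.span ℂ (Set.range f)))
    not_finite_iff_infinite.2 ‹Infinite ι› (linearIndependent_span hf).finite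
  have hC' : ∀ x ∈ E, ‖x‖ ≤ C * ‖T x‖ := fun x hx =>
    closure_minimal (t := {x | ‖x‖ ≤ C * ‖T x‖}) hC
      (isClosed_le continuous_norm (continuous_const.mul T.continuous.norm)) hx
  obtain ⟨x, hxE, hx, hTx⟩ := hT E (Submodule.isClosed_topologicalClosure _) hE (C + 1 : ℝ)⁻¹
    (by positivity)
  have : (C : ℝ) * (C + 1 : ℝ)⁻¹ < 1 := by
    rw [← div_eq_mul_inv, div_lt_one (by positivity)]
    exact lt_add_one _
  exact absurd (hC' x hxE) (not_le.2 (by rw [hx]; nlinarith [C.2]))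

lemma not_strictlySingular_of_rpow_estimates {p : ℝ} (hp : 0 < p) {K δ : ℝ≥0∞} (hK : K ≠ ∞)
    (hδ : δ ≠ 0)
    (hupper : ∀ (s : Finset ι) (a : ι → ℂ),
      ‖∑ n ∈ s, a n • f n‖ₑ ^ p ≤ K * ∑ n ∈ s, ‖a n‖ₑ ^ p)
    (hlower : ∀ (s : Finset ι) (a : ι → ℂ),
      δ * ∑ n ∈ s, ‖a n‖ₑ ^ p ≤ ‖T (∑ n ∈ s, a n • f n)‖ₑ ^ p) :
    ¬ StrictlySingular T := by
  have hindep : LinearIndependent ℂ f := by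
    refine linearIndependent_iff'.2 fun s a ha n hn => ?_
    have h := hlower s a
    simp only [ha, map_zero, enorm_zero, ENNReal.zero_rpow_of_pos hp, nonpos_iff_eq_zero,
      mul_eq_zero, hδ, false_or, Finset.sum_eq_zero_iff] at h
    simpa [hp, hp.not_gt] using h n hn
  obtain ⟨C, hC⟩ : ∃ C : NNReal, (C : ℝ≥0∞) = (K / δ) ^ p⁻¹ :=
    ⟨_, ENNReal.coe_toNNReal (by finiteness)⟩
  refine not_strictlySingular_of_norm_le (C := C) hindep fun x hx => ?_
  obtain ⟨a, rfl⟩ := Finsupp.mem_span_range_iff_exists_finsupp.1 hx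
  set x := a.sum fun i z => z • f i
  have hx : ‖x‖ₑ ≤ C * ‖T x‖ₑ := by
    rw [hC, ← ENNReal.rpow_le_rpow_iff hp, ENNReal.mul_rpow_of_nonneg _ _ hp.le,
      ENNReal.rpow_inv_rpow hp.ne', ENNReal.mul_comm_div]
    refine (hupper a.support a).trans (mul_le_mul_right ?_ K)
    rw [ENNReal.le_div_iff_mul_le (.inl hδ) (.inr (by finiteness)), mul_comm]
    exact hlower a.support a
  simp only [enorm_eq_nnnorm] at hx
  exact_mod_cast hx

end NotStrictlySingular

section Lorentz

variable {ι : Type*} {r s : ℝ}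

lemma pairwiseDisjoint_dyadicBlock :
    Pairwise (Function.onFun Disjoint fun n => Finset.Ico (2 ^ n) (2 ^ (n + 1))) := by
  have hmono : Monotone fun n : ℕ => 2 ^ n := pow_right_mono₀ one_le_two
  intro m n hmn
  simpa [Function.onFun, ← Finset.disjoint_coe] using hmono.pairwise_disjoint_on_Ico_succ hmn

lemma Lorentz.sum_le_eNorm_rpow_of_dyadic (hs : 1 ≤ s) (hr : s ≤ r) (c : ι → ℂ) {e : ℕ → ι}
    (he : Function.Injective e) (S : Finset ℕ) (b : ℕ → ℝ≥0∞)
    (hb : ∀ n ∈ S, ∀ k ∈ Finset.Ico (2 ^ n) (2 ^ (n + 1)),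
      (2 ^ n : ℝ≥0∞) ^ (-r⁻¹) * b n ≤ ‖c (e k)‖ₑ) :
    2 ^ (s / r - 1) * ∑ n ∈ S, b n ^ s ≤ eNorm r s c ^ s := by
  have hs0 : 0 < s := one_pos.trans_le hs
  have hblock (n : ℕ) (hn : n ∈ S) : 2 ^ (s / r - 1) * b n ^ s ≤
      ∑ k ∈ Finset.Ico (2 ^ n) (2 ^ (n + 1)), (weight r s k * ‖c (e k)‖ₑ) ^ s := by
    calc 2 ^ (s / r - 1) * b n ^ s
        = (Finset.Ico (2 ^ n) (2 ^ (n + 1))).card •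
            ((2 ^ (n + 1) : ℝ≥0∞) ^ (1 / r - 1 / s) * ((2 ^ n : ℝ≥0∞) ^ (-r⁻¹) * b n)) ^ s := by
          simp_rw [Nat.card_Ico, pow_succ, mul_two, Nat.add_sub_cancel, ← mul_two, ← pow_succ,
            nsmul_eq_mul, Nat.cast_pow, Nat.cast_ofNat, ← ENNReal.rpow_natCast]
          rw [← mul_assoc, ENNReal.mul_rpow_of_nonneg _ _ hs0.le,
            ENNReal.mul_rpow_of_nonneg _ _ hs0.le, ← mul_assoc]
          simp_rw [← ENNReal.rpow_mul]
          rw [← mul_assoc, ← ENNReal.rpow_add _ _ two_ne_zero ENNReal.ofNat_ne_top,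
            ← ENNReal.rpow_add _ _ two_ne_zero ENNReal.ofNat_ne_top]
          congr 2
          push_cast
          field_simp
          ring
      _ ≤ _ := by
          refine Finset.card_nsmul_le_sum _ _ _ fun k hk => ?_
          gcongr
          · convert weight_antitone hs hr (Nat.le_sub_one_of_lt (Finset.mem_Ico.1 hk).2)
            rw [weight]
            norm_cast
            rw [Nat.sub_add_cancel Nat.one_le_two_pow]
          · exact hb n hn k hk
  set K := S.biUnion fun n => Finset.Ico (2 ^ n) (2 ^ (n + 1))
  obtain ⟨N, hN⟩ := K.exists_nat_subset_range
  have hK := sum_inj_le hs hr c N K hN e he.injOn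
  rw [one_div, ENNReal.rpow_inv_le_iff hs0,
    Finset.sum_biUnion fun m _ n _ hmn => pairwiseDisjoint_dyadicBlock hmn] at hK
  rw [Finset.mul_sum]
  exact (Finset.sum_le_sum hblock).trans hK

lemma LorentzSeq.enorm_eq [Fact (1 ≤ s)] [Fact (s ≤ r)] (c : LorentzSeq ι r s) :
    ‖c‖ₑ = Lorentz.eNorm r s c :=
  (ofReal_norm c).symm.trans (ENNReal.ofReal_toReal c.2.ne)

end Lorentz

section Schur

variable {α ι : Type*} [MeasurableSpace α] {μ : Measure α}

lemma lintegral_sum_mul_rpow_le {p : ℝ} (hp : 1 ≤ p) (s : Finset ι) (x : ι → ℝ≥0∞)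
    {φ : ι → α → ℝ≥0∞} (hφ : ∀ n ∈ s, Measurable (φ n)) {h : α → ℝ≥0∞} (hh : Measurable h)
    {A B : ℝ≥0∞} (hA : ∀ t, ∑ n ∈ s, φ n t ≤ A * h t)
    (hB : ∀ n ∈ s, ∫⁻ t, h t ^ (p - 1) * φ n t ∂μ ≤ B) :
    ∫⁻ t, (∑ n ∈ s, x n * φ n t) ^ p ∂μ ≤ A ^ (p - 1) * B * ∑ n ∈ s, x n ^ p := by
  have hp0 : 0 < p := one_pos.trans_le hp
  have hp1 : 0 ≤ p - 1 := sub_nonneg.2 hp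
  have hpoint (t : α) : (∑ n ∈ s, x n * φ n t) ^ p ≤
      A ^ (p - 1) * ∑ n ∈ s, x n ^ p * (h t ^ (p - 1) * φ n t) := by
    calc (∑ n ∈ s, x n * φ n t) ^ p
        ≤ ((∑ n ∈ s, φ n t) ^ (1 - p⁻¹) * (∑ n ∈ s, φ n t * x n ^ p) ^ p⁻¹) ^ p := by
          simp_rw [mul_comm (x _)]
          gcongr
          exact ENNReal.inner_le_weight_mul_Lp_of_nonneg s hp _ _
      _ = (∑ n ∈ s, φ n t) ^ (p - 1) * ∑ n ∈ s, φ n t * x n ^ p := by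
          rw [ENNReal.mul_rpow_of_nonneg _ _ hp0.le, ENNReal.rpow_inv_rpow hp0.ne',
            ← ENNReal.rpow_mul, sub_mul, one_mul, inv_mul_cancel₀ hp0.ne']
      _ ≤ (A * h t) ^ (p - 1) * ∑ n ∈ s, φ n t * x n ^ p := by
          gcongr
          exact hA t
      _ = _ := by
          simp_rw [ENNReal.mul_rpow_of_nonneg _ _ hp1, mul_assoc, Finset.mul_sum]
          refine Finset.sum_congr rfl fun n _ => ?_
          ring
  calc ∫⁻ t, (∑ n ∈ s, x n * φ n t) ^ p ∂μ
      ≤ ∫⁻ t, A ^ (p - 1) * ∑ n ∈ s, x n ^ p * (h t ^ (p - 1) * φ n t) ∂μ := lintegral_mono hpoint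
    _ = A ^ (p - 1) * ∑ n ∈ s, x n ^ p * ∫⁻ t, h t ^ (p - 1) * φ n t ∂μ := by
        have hmeas : ∀ n ∈ s, Measurable fun t => h t ^ (p - 1) * φ n t := fun n hn =>
          (hh.pow_const _).mul (hφ n hn)
        rw [lintegral_const_mul _ (Finset.measurable_fun_sum s fun n hn =>
          (hmeas n hn).const_mul _), lintegral_finsetSum _ fun n hn => (hmeas n hn).const_mul _]
        congr 1
        exact Finset.sum_congr rfl fun n hn => lintegral_const_mul _ (hmeas n hn)
    _ ≤ A ^ (p - 1) * ∑ n ∈ s, x n ^ p * B := by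
        gcongr with n hn
        exact hB n hn
    _ = _ := by rw [← Finset.sum_mul]; ring

end Schur

section Geometric

variable {r : ℝ≥0∞}

lemma sum_range_inv_pow_le (r : ℝ≥0∞) (N : ℕ) : ∑ n ∈ Finset.range N, r⁻¹ ^ n ≤ (1 - r⁻¹)⁻¹ :=
  (ENNReal.sum_le_tsum _).trans_eq (ENNReal.tsum_geometric _)

lemma sum_pow_le_of_pow_le (hr0 : r ≠ 0) (hr : r ≠ ∞) (w : ℝ≥0∞) (N : ℕ) :
    ∑ n ∈ Finset.range N with r ^ n ≤ w, r ^ n ≤ (1 - r⁻¹)⁻¹ * w := by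
  induction N with
  | zero => simp
  | succ N ih =>
    by_cases hN : r ^ N ≤ w
    · calc ∑ n ∈ Finset.range (N + 1) with r ^ n ≤ w, r ^ n
          ≤ ∑ n ∈ Finset.range (N + 1), r ^ n := Finset.sum_le_sum_of_subset (by simp)
        _ = (∑ n ∈ Finset.range (N + 1), r⁻¹ ^ n) * r ^ N := by
            rw [← Finset.sum_range_reflect, Finset.sum_mul]
            refine Finset.sum_congr rfl fun n hn => ?_
            rw [Nat.add_sub_cancel, ← pow_sub_mul_pow r (Finset.mem_range_succ_iff.1 hn),
              mul_left_comm, ← mul_pow, ENNReal.inv_mul_cancel hr0 hr, one_pow, mul_one]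
        _ ≤ _ := mul_le_mul' (sum_range_inv_pow_le r _) hN
    · rwa [Finset.range_add_one, Finset.filter_insert, if_neg hN]

lemma sum_inv_pow_le_of_lt_pow (hr : r ≠ 0) (w : ℝ≥0∞) (N : ℕ) :
    ∑ n ∈ Finset.range N with w < r ^ n, (r ^ n)⁻¹ ≤ (1 - r⁻¹)⁻¹ * w⁻¹ := by
  by_cases hw : ∃ n, w < r ^ n
  swap
  · rw [Finset.filter_false_of_mem fun n _ hn => hw ⟨n, hn⟩]
    simp
  set n₀ := Nat.find hw
  calc ∑ n ∈ Finset.range N with w < r ^ n, (r ^ n)⁻¹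
      ≤ ∑ n ∈ Finset.Ico n₀ N, (r ^ n)⁻¹ := by
        refine Finset.sum_le_sum_of_subset fun n hn => ?_
        obtain ⟨hnN, hn⟩ := Finset.mem_filter.1 hn
        exact Finset.mem_Ico.2 ⟨Nat.find_min' hw hn, Finset.mem_range.1 hnN⟩
    _ = (∑ n ∈ Finset.range (N - n₀), r⁻¹ ^ n) * (r ^ n₀)⁻¹ := by
        rw [Finset.sum_Ico_eq_sum_range, Finset.sum_mul]
        refine Finset.sum_congr rfl fun n _ => ?_
        rw [add_comm, pow_add, ENNReal.mul_inv (.inl (pow_ne_zero _ hr)) (.inr (pow_ne_zero _ hr)),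
          ENNReal.inv_pow]
    _ ≤ _ := mul_le_mul' (sum_range_inv_pow_le r _) (ENNReal.inv_le_inv.2 (Nat.find_spec hw).le)

end Geometric

section Majorant

variable {σ : ℝ}

/-- A pointwise majorant, at distance `π / v` from the origin, of the sum of the `2^n` exponentials
in the `n`-th dyadic block of frequencies, normalised by the factor `2^{-n(1-σ)}`. -/
def dyadicMajorant (σ : ℝ) (n : ℕ) (v : ℝ≥0∞) : ℝ≥0∞ := (2 ^ n) ^ (σ - 1) * min (2 ^ n) v

lemma measurable_dyadicMajorant (σ : ℝ) (n : ℕ) : Measurable (dyadicMajorant σ n) := by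
  unfold dyadicMajorant; fun_prop

lemma two_pow_rpow (σ : ℝ) (n : ℕ) : (2 ^ n : ℝ≥0∞) ^ σ = (2 ^ σ) ^ n := by
  rw [← ENNReal.rpow_natCast, ← ENNReal.rpow_natCast, ← ENNReal.rpow_mul, ← ENNReal.rpow_mul,
    mul_comm]

lemma inv_rpow_mul_self_le (v : ℝ≥0∞) (hσ : σ < 1) : (v ^ (1 - σ))⁻¹ * v ≤ v ^ σ := by
  rcases eq_or_ne v 0 with rfl | hv0
  · simp
  rcases eq_or_ne v ∞ with rfl | hv
  · simp [sub_pos.2 hσ]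
  · rw [← ENNReal.rpow_neg]
    nth_rw 2 [← ENNReal.rpow_one v]
    rw [← ENNReal.rpow_add _ _ hv0 hv]
    simp

lemma sum_dyadicMajorant_le (hσ0 : 0 < σ) (hσ1 : σ < 1) (s : Finset ℕ) (v : ℝ≥0∞) :
    ∑ n ∈ s, dyadicMajorant σ n v ≤
      ((1 - (2 ^ σ)⁻¹)⁻¹ + (1 - (2 ^ (1 - σ))⁻¹)⁻¹) * v ^ σ := by
  have hσ1' : 0 < 1 - σ := sub_pos.2 hσ1
  have hsmall (n : ℕ) (hn : 2 ^ n ≤ v) : dyadicMajorant σ n v = (2 ^ σ) ^ n := by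
    rw [dyadicMajorant, min_eq_left hn, ← two_pow_rpow]
    nth_rw 2 [← ENNReal.rpow_one (2 ^ n)]
    rw [← ENNReal.rpow_add _ _ (by simp) (by simp), sub_add_cancel]
  have hlarge (n : ℕ) (hn : ¬ 2 ^ n ≤ v) : dyadicMajorant σ n v = ((2 ^ (1 - σ)) ^ n)⁻¹ * v := by
    rw [dyadicMajorant, min_eq_right (not_le.1 hn).le, ← two_pow_rpow, ← ENNReal.rpow_neg, neg_sub]
  obtain ⟨N, hN⟩ := s.exists_nat_subset_range
  calc ∑ n ∈ s, dyadicMajorant σ n v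
      ≤ ∑ n ∈ Finset.range N, dyadicMajorant σ n v := Finset.sum_le_sum_of_subset hN
    _ = ∑ n ∈ Finset.range N with (2 ^ σ) ^ n ≤ v ^ σ, (2 ^ σ) ^ n +
        (∑ n ∈ Finset.range N with v ^ (1 - σ) < (2 ^ (1 - σ)) ^ n, ((2 ^ (1 - σ)) ^ n)⁻¹) * v := by
      simp_rw [← two_pow_rpow, ENNReal.rpow_le_rpow_iff hσ0, ENNReal.rpow_lt_rpow_iff hσ1']
      rw [← Finset.sum_filter_add_sum_filter_not _ fun n : ℕ => (2 : ℝ≥0∞) ^ n ≤ v, Finset.sum_mul]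
      simp_rw [← not_le]
      congr 1 <;> refine Finset.sum_congr rfl fun n hn => ?_
      · rw [hsmall n (Finset.mem_filter.1 hn).2, two_pow_rpow]
      · rw [hlarge n (Finset.mem_filter.1 hn).2, two_pow_rpow]
    _ ≤ (1 - (2 ^ σ)⁻¹)⁻¹ * v ^ σ +
        (1 - (2 ^ (1 - σ))⁻¹)⁻¹ * (v ^ (1 - σ))⁻¹ * v := by
      gcongr
      · exact sum_pow_le_of_pow_le (by simp) (by finiteness) _ N
      · exact sum_inv_pow_le_of_lt_pow (by simp) _ N
    _ ≤ _ := by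
      rw [add_mul, mul_assoc _ _ v]
      gcongr
      exact inv_rpow_mul_self_le v hσ1

lemma lintegral_eq_two_mul_setLIntegral_Ioi {f : ℝ → ℝ≥0∞} (hf : ∀ x, f (-x) = f x) :
    ∫⁻ x, f x = 2 * ∫⁻ x in Set.Ioi 0, f x := by
  have hneg : ∫⁻ x in Set.Iio 0, f x = ∫⁻ x in Set.Ioi 0, f x := by
    have h := (Measure.measurePreserving_neg (volume : Measure ℝ)).setLIntegral_comp_preimage_emb
      (MeasurableEquiv.neg ℝ).measurableEmbedding f (Set.Ioi 0)
    simpa [hf] using h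
  rw [← lintegral_add_compl f measurableSet_Ioi, Set.compl_Ioi, ← restrict_Iio_eq_restrict_Iic,
    hneg, two_mul]

lemma setLIntegral_Ioc_rpow_mul_min_le {c X : ℝ} (hσ0 : 0 < σ) (hc : 0 < c) (hX : 0 < X) :
    ∫⁻ x in Set.Ioc 0 (c / X),
        ENNReal.ofReal ((c / x) ^ (1 - σ) * (X ^ (σ - 1) * min X (c / x))) ≤
      ENNReal.ofReal (c * σ⁻¹) := by
  calc _ ≤ ∫⁻ x in Set.Ioc 0 (c / X),
        ENNReal.ofReal (c ^ (1 - σ) * X ^ σ) * ENNReal.ofReal (x ^ (σ - 1)) := by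
        refine setLIntegral_mono' measurableSet_Ioc fun x hx => ?_
        have hx0 : 0 < x := hx.1
        rw [← ENNReal.ofReal_mul (by positivity)]
        refine ENNReal.ofReal_le_ofReal ?_
        calc _ ≤ (c / x) ^ (1 - σ) * (X ^ (σ - 1) * X) := by gcongr; exact min_le_left _ _
          _ = _ := by
            rw [Real.div_rpow hc.le hx0.le, div_eq_mul_inv, ← Real.rpow_neg hx0.le, neg_sub,
              ← Real.rpow_add_one hX.ne', sub_add_cancel]
            ring
    _ = ENNReal.ofReal (c * σ⁻¹) := by
        rw [lintegral_const_mul' _ _ ENNReal.ofReal_ne_top,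
          lintegral_Ioc_ofReal_rpow (by linarith) (by positivity),
          ← ENNReal.ofReal_mul (by positivity), sub_add_cancel, Real.div_rpow hc.le hX.le,
          Real.rpow_sub hc, Real.rpow_one]
        congr 1
        field_simp

lemma setLIntegral_Ioi_rpow_mul_min_le {c X : ℝ} (hσ1 : σ < 1) (hc : 0 < c) (hX : 0 < X) :
    ∫⁻ x in Set.Ioi (c / X),
        ENNReal.ofReal ((c / x) ^ (1 - σ) * (X ^ (σ - 1) * min X (c / x))) ≤
      ENNReal.ofReal (c * (1 - σ)⁻¹) := by
  have hcX : 0 < c / X := div_pos hc hX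
  calc _ ≤ ∫⁻ x in Set.Ioi (c / X),
        ENNReal.ofReal (c ^ (2 - σ) * X ^ (σ - 1)) * ENNReal.ofReal (x ^ (σ - 2)) := by
        refine setLIntegral_mono' measurableSet_Ioi fun x hx => ?_
        have hx0 : 0 < x := hcX.trans hx
        rw [← ENNReal.ofReal_mul (by positivity)]
        refine ENNReal.ofReal_le_ofReal ?_
        calc _ ≤ (c / x) ^ (1 - σ) * (X ^ (σ - 1) * (c / x)) := by gcongr; exact min_le_right _ _
          _ = (c / x) ^ (1 - σ + 1) * X ^ (σ - 1) := by
            rw [Real.rpow_add_one (by positivity)]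
            ring
          _ = _ := by
            rw [Real.div_rpow hc.le hx0.le, div_eq_mul_inv, ← Real.rpow_neg hx0.le]
            ring_nf
    _ = ENNReal.ofReal (c * (1 - σ)⁻¹) := by
        have hσ : 1 - σ ≠ 0 := by linarith
        have hσ' : σ - 1 ≠ 0 := by linarith
        rw [lintegral_const_mul' _ _ ENNReal.ofReal_ne_top,
          lintegral_Ioi_ofReal_rpow (by linarith) hcX, ← ENNReal.ofReal_mul (by positivity),
          show 2 - σ = 1 - (σ - 1) by ring, show σ - 2 + 1 = σ - 1 by ring,
          Real.div_rpow hc.le hX.le, Real.rpow_sub hc, Real.rpow_one]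
        congr 1
        field_simp
        ring

lemma setLIntegral_Ioi_zero_rpow_mul_min_le {c X : ℝ} (hσ0 : 0 < σ) (hσ1 : σ < 1) (hc : 0 < c)
    (hX : 0 < X) :
    ∫⁻ x in Set.Ioi 0, ENNReal.ofReal ((c / x) ^ (1 - σ) * (X ^ (σ - 1) * min X (c / x))) ≤
      ENNReal.ofReal (c * (σ⁻¹ + (1 - σ)⁻¹)) := by
  have := sub_pos.2 hσ1
  rw [← Set.Ioc_union_Ioi_eq_Ioi (div_pos hc hX).le, lintegral_union measurableSet_Ioi
    (Set.Ioc_disjoint_Ioi le_rfl), mul_add, ENNReal.ofReal_add (by positivity) (by positivity)]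
  exact add_le_add (setLIntegral_Ioc_rpow_mul_min_le hσ0 hc hX)
    (setLIntegral_Ioi_rpow_mul_min_le hσ1 hc hX)

lemma setLIntegral_dyadicMajorant_le (hσ0 : 0 < σ) (hσ1 : σ < 1) (n : ℕ) (s : Set ℝ) :
    ∫⁻ x in s, (ENNReal.ofReal Real.pi / ‖x‖ₑ) ^ (1 - σ) *
        dyadicMajorant σ n (ENNReal.ofReal Real.pi / ‖x‖ₑ) ≤
      2 * ENNReal.ofReal (Real.pi * (σ⁻¹ + (1 - σ)⁻¹)) := by
  refine (setLIntegral_le_lintegral _ _).trans ?_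
  rw [lintegral_eq_two_mul_setLIntegral_Ioi fun x => by rw [enorm_neg]]
  refine mul_le_mul_right ((setLIntegral_congr_fun measurableSet_Ioi fun x hx => ?_).trans_le
    (setLIntegral_Ioi_zero_rpow_mul_min_le (X := 2 ^ n) hσ0 hσ1 Real.pi_pos (by positivity))) 2
  have hx0 : 0 < x := hx
  have hpow : (2 : ℝ≥0∞) ^ n = ENNReal.ofReal (2 ^ n) := by
    rw [ENNReal.ofReal_pow zero_le_two, ENNReal.ofReal_ofNat]
  rw [dyadicMajorant, Real.enorm_of_nonneg hx0.le, ← ENNReal.ofReal_div_of_pos hx0, hpow,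
    ENNReal.ofReal_rpow_of_pos (by positivity), ENNReal.ofReal_rpow_of_pos (by positivity),
    ← ENNReal.ofReal_min, ← ENNReal.ofReal_mul (by positivity),
    ← ENNReal.ofReal_mul (by positivity)]

end Majorant

lemma enorm_sum_Ico_exp_pow_le {x : ℝ} (hx : |x| ≤ Real.pi) {m n : ℕ} (hmn : m ≤ n) :
    ‖∑ k ∈ Finset.Ico m n, Complex.exp (Complex.I * x) ^ k‖ₑ ≤ ENNReal.ofReal Real.pi / ‖x‖ₑ := by
  set z := Complex.exp (Complex.I * x)
  have hz (k : ℕ) : ‖z ^ k‖ = 1 := by rw [norm_pow, Complex.norm_exp_I_mul_ofReal, one_pow]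
  have hsin : 2 * |x| ≤ Real.pi * ‖z - 1‖ := by
    have h := Real.mul_abs_le_abs_sin (x := x / 2) (by rw [abs_div, abs_two]; linarith)
    rw [Complex.norm_exp_I_mul_ofReal_sub_one, norm_mul, Real.norm_two, Real.norm_eq_abs]
    rw [abs_div, abs_two, div_mul_div_comm, div_le_iff₀ (by positivity)] at h
    linarith
  have hgeom : ‖∑ k ∈ Finset.Ico m n, z ^ k‖ * ‖z - 1‖ ≤ 2 := by
    rw [← norm_mul, geom_sum_Ico_mul _ hmn]
    exact (norm_sub_le _ _).trans_eq (by rw [hz, hz, one_add_one_eq_two])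
  have hreal : ‖∑ k ∈ Finset.Ico m n, z ^ k‖ * |x| ≤ Real.pi := by
    nlinarith [norm_nonneg (∑ k ∈ Finset.Ico m n, z ^ k), Real.pi_pos]
  rw [ENNReal.le_div_iff_mul_le (.inr (by simp [Real.pi_pos])) (.inl enorm_ne_top),
    ← ofReal_norm, ← ofReal_norm x, ← ENNReal.ofReal_mul (norm_nonneg _)]
  exact ENNReal.ofReal_le_ofReal hreal

section DyadicPoly

variable {d : ℕ} {p : ℝ}

lemma lintegral_comp_eval_torusMeasure (i : Fin d) {g : ℝ → ℝ≥0∞} (hg : Measurable g) :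
    ∫⁻ t, g (t i) ∂(torusMeasure d) =
      ENNReal.ofReal (Real.pi + Real.pi) ^ (d - 1) *
        ∫⁻ x in Set.Icc (-Real.pi) Real.pi, g x := by
  have hmap : (torusMeasure d).map (fun t => t i) = ENNReal.ofReal (Real.pi + Real.pi) ^ (d - 1) •
      (volume : Measure ℝ).restrict (Set.Icc (-Real.pi) Real.pi) := by
    rw [torusMeasure_eq_pi]
    exact (Measure.pi_map_eval _ i).trans (by simp)
  rw [← lintegral_map hg (measurable_pi_apply i), hmap, lintegral_smul_measure, smul_eq_mul]

/-- The normalised exponential sum `t ↦ 2^{-n(1-σ)} ∑_{2^n ≤ k < 2^{n+1}} e^{ik t_i}`. For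
`σ = 1/p` the spans of these functions are copies of `ℓ^p` on which the Fourier transform is
bounded below. -/
def dyadicPoly (i : Fin d) (σ : ℝ) (n : ℕ) (t : Fin d → ℝ) : ℂ :=
  (((2 ^ n) ^ (σ - 1) : ℝ) : ℂ) *
    ∑ k ∈ Finset.Ico (2 ^ n : ℕ) (2 ^ (n + 1)), star (torusChar (Pi.single i (k : ℤ)) t)

lemma star_torusChar_single (i : Fin d) (k : ℕ) (t : Fin d → ℝ) :
    star (torusChar (Pi.single i (k : ℤ)) t) = Complex.exp (Complex.I * t i) ^ k := by
  have hsum : ∑ j, t j * ((Pi.single i (k : ℤ) : Fin d → ℤ) j : ℝ) = t i * k := by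
    rw [Fintype.sum_eq_single i fun j hj => by simp [hj]]
    simp
  rw [torusChar, hsum, ← Complex.exp_nat_mul, Complex.star_def, ← Complex.exp_conj]
  simp only [map_mul, map_neg, Complex.conj_I, Complex.conj_ofReal]
  push_cast
  ring_nf

lemma enorm_two_pow_rpow (σ : ℝ) (n : ℕ) : ‖(((2 ^ n) ^ σ : ℝ) : ℂ)‖ₑ = (2 ^ n : ℝ≥0∞) ^ σ := by
  rw [← ofReal_norm, Complex.norm_real, Real.norm_of_nonneg (by positivity),
    ← ENNReal.ofReal_rpow_of_pos (by positivity), ENNReal.ofReal_pow zero_le_two,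
    ENNReal.ofReal_ofNat]

lemma enorm_dyadicPoly_le (i : Fin d) (σ : ℝ) (n : ℕ) {t : Fin d → ℝ} (ht : |t i| ≤ Real.pi) :
    ‖dyadicPoly i σ n t‖ₑ ≤ dyadicMajorant σ n (ENNReal.ofReal Real.pi / ‖t i‖ₑ) := by
  rw [dyadicPoly, enorm_mul, enorm_two_pow_rpow, dyadicMajorant]
  refine mul_le_mul_right (le_min ?_ ?_) _
  · refine (enorm_sum_le _ _).trans_eq ?_
    simp [← ofReal_norm, norm_torusChar, pow_succ, mul_two]
  · simp_rw [star_torusChar_single]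
    exact enorm_sum_Ico_exp_pow_le ht (Nat.pow_le_pow_right two_pos n.le_succ)

lemma memLp_dyadicPoly (i : Fin d) (σ : ℝ) (n : ℕ) (q : ℝ≥0∞) :
    MemLp (dyadicPoly i σ n) q (torusMeasure d) := by
  unfold dyadicPoly
  exact (memLp_finsetSum _ fun k _ => (memLp_torusChar _ q).star).const_mul _

lemma torusFourierCoeff_dyadicPoly (i : Fin d) (σ : ℝ) (n k : ℕ) :
    torusFourierCoeff (dyadicPoly i σ n) (Pi.single i (k : ℤ)) =
      if k ∈ Finset.Ico (2 ^ n) (2 ^ (n + 1)) then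
        (((2 ^ n) ^ (σ - 1) * (torusMeasure d).real Set.univ : ℝ) : ℂ) else 0 := by
  have hint (l : ℕ) : Integrable (fun t => torusChar (Pi.single i (k : ℤ)) t *
      star (torusChar (Pi.single i (l : ℤ)) t)) (torusMeasure d) := by
    simp_rw [torusChar_mul_star]
    exact (memLp_torusChar _ 1).integrable le_rfl
  simp_rw [torusFourierCoeff_eq, dyadicPoly, mul_assoc, Finset.sum_mul, mul_comm (star _)]
  rw [integral_const_mul, integral_finsetSum _ fun l _ => hint l]
  simp_rw [integral_torusChar_mul_star, (Pi.single_injective i).eq_iff, Nat.cast_inj]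
  rw [Finset.sum_ite_eq]
  simp

lemma inv_one_sub_inv_two_rpow_ne_top {σ : ℝ} (hσ : 0 < σ) : (1 - (2 ^ σ : ℝ≥0∞)⁻¹)⁻¹ ≠ ∞ := by
  have h : 1 < (2 : ℝ≥0∞) ^ σ := ENNReal.one_lt_rpow (by norm_num) hσ
  exact ENNReal.inv_ne_top.2 (tsub_pos_of_lt (ENNReal.inv_lt_one.2 h)).ne'

lemma exists_setLIntegral_sum_mul_dyadicMajorant_rpow_le (hp : 1 < p) (S : Set ℝ) :
    ∃ K : ℝ≥0∞, K ≠ ∞ ∧ ∀ (s : Finset ℕ) (b : ℕ → ℝ≥0∞),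
      ∫⁻ x in S, (∑ n ∈ s, b n * dyadicMajorant p⁻¹ n (ENNReal.ofReal Real.pi / ‖x‖ₑ)) ^ p ≤
        K * ∑ n ∈ s, b n ^ p := by
  have hp0 : 0 < p := one_pos.trans hp
  have hσ0 : 0 < p⁻¹ := inv_pos.2 hp0
  have hσ1 : p⁻¹ < 1 := inv_lt_one_of_one_lt₀ hp
  have hv : Measurable fun x : ℝ => ENNReal.ofReal Real.pi / ‖x‖ₑ := by fun_prop
  have hA₁ := inv_one_sub_inv_two_rpow_ne_top hσ0
  have hA₂ := inv_one_sub_inv_two_rpow_ne_top (sub_pos.2 hσ1)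
  have hexp : 0 ≤ p - 1 := (sub_pos.2 hp).le
  refine ⟨((1 - (2 ^ p⁻¹)⁻¹)⁻¹ + (1 - (2 ^ (1 - p⁻¹))⁻¹)⁻¹) ^ (p - 1) *
    (2 * ENNReal.ofReal (Real.pi * (p⁻¹⁻¹ + (1 - p⁻¹)⁻¹))), by finiteness, fun s b => ?_⟩
  refine lintegral_sum_mul_rpow_le hp.le s b
    (fun n _ => (measurable_dyadicMajorant _ n).comp hv) (hv.pow_const p⁻¹)
    (fun x => sum_dyadicMajorant_le hσ0 hσ1 s _) fun n _ => ?_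
  simp_rw [← ENNReal.rpow_mul, mul_sub, inv_mul_cancel₀ hp0.ne', mul_one]
  exact setLIntegral_dyadicMajorant_le hσ0 hσ1 n S

lemma exists_lintegral_sum_mul_dyadicPoly_rpow_le (hp : 1 < p) (i : Fin d) :
    ∃ K : ℝ≥0∞, K ≠ ∞ ∧ ∀ (s : Finset ℕ) (a : ℕ → ℂ),
      ∫⁻ t, ‖∑ n ∈ s, a n * dyadicPoly i p⁻¹ n t‖ₑ ^ p ∂(torusMeasure d) ≤
        K * ∑ n ∈ s, ‖a n‖ₑ ^ p := by
  obtain ⟨K, hK, hKle⟩ :=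
    exists_setLIntegral_sum_mul_dyadicMajorant_rpow_le hp (Set.Icc (-Real.pi) Real.pi)
  refine ⟨ENNReal.ofReal (Real.pi + Real.pi) ^ (d - 1) * K, by finiteness, fun s a => ?_⟩
  set F : ℝ → ℝ≥0∞ := fun x =>
    (∑ n ∈ s, ‖a n‖ₑ * dyadicMajorant p⁻¹ n (ENNReal.ofReal Real.pi / ‖x‖ₑ)) ^ p
  have hF : Measurable F := by
    have := measurable_dyadicMajorant p⁻¹
    fun_prop
  calc ∫⁻ t, ‖∑ n ∈ s, a n * dyadicPoly i p⁻¹ n t‖ₑ ^ p ∂(torusMeasure d)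
      ≤ ∫⁻ t, F (t i) ∂(torusMeasure d) := by
        refine setLIntegral_mono' measurableSet_Icc fun t ht =>
          ENNReal.rpow_le_rpow ?_ (by linarith)
        refine (enorm_sum_le _ _).trans (Finset.sum_le_sum fun n _ => ?_)
        rw [enorm_mul]
        gcongr
        exact enorm_dyadicPoly_le i _ n (abs_le.2 ⟨ht.1 i, ht.2 i⟩)
    _ = ENNReal.ofReal (Real.pi + Real.pi) ^ (d - 1) * ∫⁻ x in Set.Icc (-Real.pi) Real.pi, F x :=
        lintegral_comp_eval_torusMeasure i hF
    _ ≤ _ := by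
        rw [mul_assoc]
        gcongr
        exact hKle s _

end DyadicPoly

lemma LorentzSeq.sum_smul_apply {ι κ : Type*} {r s : ℝ} [Fact (1 ≤ s)] [Fact (s ≤ r)]
    (S : Finset κ) (a : κ → ℂ) (c : κ → LorentzSeq ι r s) (m : ι) :
    (∑ n ∈ S, a n • c n) m = ∑ n ∈ S, a n * c n m := by
  let eval : LorentzSeq ι r s →ₗ[ℂ] ℂ :=
    (LinearMap.proj m : (ι → ℂ) →ₗ[ℂ] ℂ) ∘ₗ (Lorentz.finiteNorm ι r s).subtype
  exact (map_sum eval _ S).trans (Finset.sum_congr rfl fun n _ => map_smul eval (a n) (c n))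

section DyadicLp

variable {d : ℕ} {p : ℝ}

/-- `dyadicPoly i p⁻¹ n` as an element of `L^p(𝕋^d)`. -/
def dyadicLp (i : Fin d) (p : ℝ) (n : ℕ) : Lp ℂ (ENNReal.ofReal p) (torusMeasure d) :=
  (memLp_dyadicPoly i p⁻¹ n _).toLp

lemma exists_enorm_sum_smul_dyadicLp_rpow_le (hp : 1 < p) (i : Fin d) :
    ∃ K : ℝ≥0∞, K ≠ ∞ ∧ ∀ (s : Finset ℕ) (a : ℕ → ℂ),
      ‖∑ n ∈ s, a n • dyadicLp i p n‖ₑ ^ p ≤ K * ∑ n ∈ s, ‖a n‖ₑ ^ p := by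
  obtain ⟨K, hK, hKle⟩ := exists_lintegral_sum_mul_dyadicPoly_rpow_le hp i
  refine ⟨K, hK, fun s a => ?_⟩
  rw [enorm_Lp_rpow (one_pos.trans hp)]
  refine (lintegral_congr_ae ?_).trans_le (hKle s a)
  have hterm : ∀ᵐ t ∂(torusMeasure d), ∀ n,
      (a n • dyadicLp i p n : Lp ℂ (ENNReal.ofReal p) (torusMeasure d)) t =
        a n * dyadicPoly i p⁻¹ n t := ae_all_iff.2 fun n => by
    filter_upwards [Lp.coeFn_smul (a n) (dyadicLp i p n),
      (memLp_dyadicPoly i p⁻¹ n (ENNReal.ofReal p)).coeFn_toLp] with t hsmul htoLp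
    rw [hsmul, Pi.smul_apply, dyadicLp, htoLp, smul_eq_mul]
  filter_upwards [Lp.coeFn_finsetSum s fun n => a n • dyadicLp i p n, hterm] with t hsum ht
  simp_rw [hsum, Finset.sum_apply, ht]

variable [h1 : Fact (1 < p)] [h2 : Fact (p < 2)]

lemma torusFourier_sum_smul_dyadicLp (i : Fin d) (s : Finset ℕ) (a : ℕ → ℂ) {n k : ℕ}
    (hn : n ∈ s) (hk : k ∈ Finset.Ico (2 ^ n) (2 ^ (n + 1))) :
    torusFourier d p (∑ n ∈ s, a n • dyadicLp i p n) (Pi.single i (k : ℤ)) =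
      a n * ((2 ^ n) ^ (p⁻¹ - 1) * (torusMeasure d).real Set.univ : ℝ) := by
  have hcoeff (m : ℕ) : torusFourier d p (dyadicLp i p m) (Pi.single i (k : ℤ)) =
      torusFourierCoeff (dyadicPoly i p⁻¹ m) (Pi.single i (k : ℤ)) := by
    rw [torusFourier_apply, dyadicLp, torusFourierCoeff_congr (MemLp.coeFn_toLp _)]
  simp_rw [map_sum, map_smul, LorentzSeq.sum_smul_apply, hcoeff, torusFourierCoeff_dyadicPoly]
  rw [Finset.sum_eq_single_of_mem n hn fun m _ hmn => ?_, if_pos hk]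
  rw [if_neg (Finset.disjoint_left.1 (pairwiseDisjoint_dyadicBlock hmn.symm) hk), mul_zero]

lemma sum_rpow_le_enorm_torusFourier_sum_smul_dyadicLp (i : Fin d) (s : Finset ℕ) (a : ℕ → ℂ) :
    2 ^ (p / p.conjExponent - 1) * ENNReal.ofReal ((torusMeasure d).real Set.univ) ^ p *
        ∑ n ∈ s, ‖a n‖ₑ ^ p ≤
      ‖torusFourier d p (∑ n ∈ s, a n • dyadicLp i p n)‖ₑ ^ p := by
  have hp0 : 0 < p := one_pos.trans h1.out
  have hexp : p⁻¹ - 1 = -p.conjExponent⁻¹ := by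
    rw [Real.conjExponent]
    field_simp
    ring
  rw [LorentzSeq.enorm_eq, mul_assoc, Finset.mul_sum]
  simp_rw [← ENNReal.mul_rpow_of_nonneg _ _ hp0.le]
  refine Lorentz.sum_le_eNorm_rpow_of_dyadic h1.out.le factLeConjExponent.out _
    ((Pi.single_injective i).comp Nat.cast_injective) s
    (fun n => ENNReal.ofReal ((torusMeasure d).real Set.univ) * ‖a n‖ₑ) fun n hn k hk => ?_
  rw [Function.comp_apply, torusFourier_sum_smul_dyadicLp i s a hn hk, Complex.ofReal_mul,
    enorm_mul, enorm_mul, enorm_two_pow_rpow, hexp, ← ofReal_norm (Complex.ofReal _),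
    Complex.norm_real, Real.norm_of_nonneg measureReal_nonneg]
  exact le_of_eq (by ring)

end DyadicLp

end

theorem theorem5p1 (d : ℕ) (hd : 0 < d) (p : ℝ) [Fact (1 < p)] [Fact (p < 2)] :
    ∃ T : Lp ℂ (ENNReal.ofReal p) (torusMeasure d) →L[ℂ]
        LorentzSeq (Fin d → ℤ) p.conjExponent p,
      (∀ (f : Lp ℂ (ENNReal.ofReal p) (torusMeasure d)) (m : Fin d → ℤ),
        T f m = torusFourierCoeff f m) ∧
      ¬ StrictlySingular T := by
  have hp : 1 < p := Fact.out
  let i : Fin d := ⟨0, hd⟩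
  obtain ⟨K, hK, hupper⟩ := exists_enorm_sum_smul_dyadicLp_rpow_le hp i
  refine ⟨torusFourier d p, torusFourier_apply, not_strictlySingular_of_rpow_estimates
    (one_pos.trans hp) hK ?_ hupper (sum_rpow_le_enorm_torusFourier_sum_smul_dyadicLp i)⟩
  have hM : 0 < ENNReal.ofReal ((torusMeasure d).real Set.univ) ^ p :=
    ENNReal.rpow_pos (ENNReal.ofReal_pos.2 torusMeasure_real_univ_pos) ENNReal.ofReal_ne_top
  exact mul_ne_zero (by simp) hM.ne'
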